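/- **Setting.** Let $\Sigma_3=\{0,1,2\}^{\mathbb Z}$ with the product topology and the left shift $\sigma$. Let $\Phi$ be a $C^1$ diffeomorphism of $\mathbb R^2$ and let $\widehat{\mathbf C}_0,\widehat{\mathbf C}_1,\widehat{\mathbf C}_2\subset[0,1]^2$ be pairwise disjoint closed sets such that the maximal $\Phi$-invariant set $\Gamma=\bigcap_{n\in\mathbb Z}\Phi^n(\widehat{\mathbf C}_0\cup\widehat{\mathbf C}_1\cup\widehat{\mathbf C}_2)$ is a horseshoe with three legs, in the sense that there is a homeomorphism $\varpi\colon\Gamma\to\Sigma_3$ with $\varpi\circ\Phi=\sigma\circ\varpi$ and $\Gamma\cap\widehat{\mathbf C}_i=\{\theta\in\Gamma:\varpi(\theta)_0=i\}$ for $i=0,1,2$. Let $f_0,f_1,f_2\colon[0,1]\to[0,1]$ be injective $C^1$ maps whose derivatives have no zeros, such that * (F0) $f_0$ is increasing, its fixed points are exactly $0$ and $1$, $f_0'(0)>1$, $\lambda_0:=f_0'(1)\in(0,1)$, and $f_0'\ge\lambda_0$ on $[0,1]$; * (F1) $f_1(x)=\gamma(1-x)$ for some $\gamma\in[\lambda_0,1)$;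 * (F2) $f_2$ is increasing, $f_2(0)=0$, $f_2'(0)>1$, and $f_2$ has a fixed point $p_2\in(0,1)$ with $|f_2'(p_2)|<1$. Let $F(\widehat x,x)=(\Phi(\widehat x),f_i(x))$ for $(\widehat x,x)\in\widehat{\mathbf C}_i\times[0,1]$, $i=0,1,2$, and let $\Lambda\subset[0,1]^3$ be the maximal invariant set of $F$, i.e. the set of points through which there passes a two-sided $F$-orbit contained in $\bigcup_i\widehat{\mathbf C}_i\times[0,1]$. Let $\pi\colon\Lambda\to\Sigma_3$, $\pi(\widehat x,x)=\varpi(\widehat x)$, so that $\pi\circ F=\sigma\circ\pi$. For an $F$-invariant Borel probability measure $\mu$ on $\Lambda$ let $h_\mu(F)$ be its Kolmogorov–Sinai entropy and let $\chi(\mu)=\int\log\|dF|_{E^c}\|\,d\mu$ be its central Lyapunov exponent, where $E^c=\{(0,0)\}\times\mathbb R$, so that $\|dF|_{E^c_{(\widehat x,x)}}\|=|f_i'(x)|$ for $\widehat x\in\widehat{\mathbf C}_i$. For $\xi\in\Sigma_3$ let $p^-_\xi\le p^+_\xi$ be the minimum and the maximum of the fibre $\{x:(\varpi^{-1}(\xi),x)\in\Lambda\}$.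 For $m\ge1$ let $S_m$ be the finite set of all $\xi\in\Sigma_3$ with $\sigma^m\xi=\xi$ in which the symbol $1$ occurs, and put $$\mu_m=\frac1{\operatorname{card}S_m}\sum_{\xi\in S_m}\frac12\Big(\delta_{(\varpi^{-1}(\xi),p^-_\xi)}+\delta_{(\varpi^{-1}(\xi),p^+_\xi)}\Big).$$ **Proposition.** 1. There is an ergodic $F$-invariant Borel probability measure $\mu$ on $\Lambda$ with $$h_\mu(F)=\log 3\qquad\text{and}\qquad \chi(\mu)\le 0 .$$ It is a measure of maximal entropy, that is, $h_\nu(F)\le h_\mu(F)$ for every $F$-invariant Borel probability measure $\nu$ on $\Lambda$, and it can be chosen so that $\pi_*\mu$ is the $(\frac13,\frac13,\frac13)$-Bernoulli measure. 2. The sequence $(\mu_m)_{m\ge1}$ has a weak accumulation point among the Borel probability measures on $\Lambda$, and every such accumulation point $\mu$ is $F$-invariant, projects under $\pi$ to the $(\frac13,\frac13,\frac13)$-Bernoulli measure, and satisfies $h_\mu(F)=\log3$ and $\chi(\mu)\le0$. -/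

import Mathlib

open Set Filter Topology MeasureTheory

noncomputable section

namespace SkewHorseshoe

/-! ### The full shift on three symbols -/

/-- The space of two-sided sequences in the symbols `0, 1, 2`, with the product topology and the
product (that is, Borel) `σ`-algebra. -/
abbrev Seq3 : Type := ℤ → Fin 3

/-- The left shift. -/
def shift (ξ : Seq3) : Seq3 := fun n => ξ (n + 1)

/-- The `(1/3, 1/3, 1/3)`-Bernoulli measure. -/
def bernoulli3 : Measure Seq3 :=
  Measure.infinitePi fun _ : ℤ => (PMF.uniformOfFintype (Fin 3)).toMeasure

/-- The periodic sequence `(w₀ … w_{m-1})^ℤ`; the period `m` need not be the least one. -/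
def periodicSeq {m : ℕ} [NeZero m] (w : Fin m → Fin 3) : Seq3 :=
  fun n => w (Fin.ofNat m (n % (m : ℤ)).toNat)

/-! ### The planar horseshoe -/

/-- A diffeomorphism `Φ` of the plane together with three pairwise disjoint closed pieces
`Ĉ₀, Ĉ₁, Ĉ₂` of the unit square. -/
structure PlanarPieces where
  Φ : Equiv.Perm (ℝ × ℝ)
  contDiff_Φ : ContDiff ℝ 1 Φ
  contDiff_Φ_symm : ContDiff ℝ 1 Φ.symm
  cube : Fin 3 → Set (ℝ × ℝ)
  isClosed_cube : ∀ i, IsClosed (cube i)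
  cube_subset : ∀ i, cube i ⊆ Icc (0 : ℝ) 1 ×ˢ Icc (0 : ℝ) 1
  disjoint_cube : ∀ i j, i ≠ j → Disjoint (cube i) (cube j)

/-- The maximal `Φ`-invariant set `Γ` in `Ĉ₀ ∪ Ĉ₁ ∪ Ĉ₂`. -/
def PlanarPieces.Γ (B : PlanarPieces) : Set (ℝ × ℝ) :=
  {θ | ∀ n : ℤ, (B.Φ ^ n) θ ∈ ⋃ i, B.cube i}

theorem PlanarPieces.mapsTo_Γ (B : PlanarPieces) : MapsTo B.Φ B.Γ B.Γ := by
  intro θ hθ n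
  have h := hθ (n + 1)
  rwa [zpow_add, zpow_one, Equiv.Perm.mul_apply] at h

/-- A horseshoe with three legs: the maximal invariant set `Γ` of `Φ` in the union of the three
pieces is conjugate to the full shift by a homeomorphism `ϖ`, and the piece `Ĉᵢ` contains exactly
the points of `Γ` with zeroth symbol `i`. (Affinity of `Φ` on the pieces and uniform hyperbolicity
of `Γ` are not required.) -/
structure Horseshoe extends PlanarPieces where
  ϖ : toPlanarPieces.Γ ≃ₜ Seq3
  conj : ∀ θ : toPlanarPieces.Γ, ϖ (toPlanarPieces.mapsTo_Γ.restrict _ _ _ θ) = shift (ϖ θ)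
  coding : ∀ (θ : toPlanarPieces.Γ) (i : Fin 3), θ.1 ∈ cube i ↔ ϖ θ 0 = i

/-! ### The fibre maps -/

/-- The derivative of an interval map `g : [0,1] → ℝ` (one-sided at the end points). -/
def dIcc (g : ℝ → ℝ) (x : ℝ) : ℝ := derivWithin g (Icc 0 1) x

/-- Three injective `C¹` maps `[0,1] → [0,1]` with non-vanishing derivative (only the values on
`[0,1]` matter) which satisfy the conditions (F0), (F1), (F2). -/
structure FibreMaps where
  f : Fin 3 → ℝ → ℝ
  mapsTo : ∀ i, MapsTo (f i) (Icc 0 1) (Icc 0 1)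
  injOn : ∀ i, InjOn (f i) (Icc 0 1)
  contDiffOn : ∀ i, ContDiffOn ℝ 1 (f i) (Icc 0 1)
  deriv_ne_zero : ∀ i, ∀ x ∈ Icc (0 : ℝ) 1, dIcc (f i) x ≠ 0
  /-- (F0): `f₀` is increasing, its only fixed points are the repelling point `0` and the
  attracting point `1`, and `λ₀ = f₀'(1)` is the least value of `f₀'`. -/
  f0_increasing : StrictMonoOn (f 0) (Icc 0 1)
  f0_fixed : ∀ x ∈ Icc (0 : ℝ) 1, f 0 x = x ↔ x = 0 ∨ x = 1
  f0_repelling : 1 < dIcc (f 0) 0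
  f0_attracting : dIcc (f 0) 1 ∈ Ioo (0 : ℝ) 1
  f0_deriv_ge : ∀ x ∈ Icc (0 : ℝ) 1, dIcc (f 0) 1 ≤ dIcc (f 0) x
  /-- (F1): `f₁(x) = γ (1 - x)` is an affine contraction, with `γ ≥ λ₀`. -/
  γ : ℝ
  γ_lt_one : γ < 1
  γ_ge : dIcc (f 0) 1 ≤ γ
  f1_eq : ∀ x ∈ Icc (0 : ℝ) 1, f 1 x = γ * (1 - x)
  /-- (F2): `f₂` is increasing and has the repelling fixed point `0` and an attracting fixed
  point `p₂` in `(0,1)`. -/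
  f2_increasing : StrictMonoOn (f 2) (Icc 0 1)
  f2_zero : f 2 0 = 0
  f2_repelling : 1 < dIcc (f 2) 0
  p2 : ℝ
  p2_mem : p2 ∈ Ioo (0 : ℝ) 1
  f2_p2 : f 2 p2 = p2
  f2_attracting : |dIcc (f 2) p2| < 1

/-! ### The skew product -/

/-- The data of the skew product. -/
structure SkewSystem extends Horseshoe, FibreMaps

namespace SkewSystem

variable (S : SkewSystem)

/-- The domain `⋃ᵢ Ĉᵢ × [0,1]` of `F`, a subset of the cube `[0,1]³`. -/
def dom : Set ((ℝ × ℝ) × ℝ) := (⋃ i, S.cube i) ×ˢ Icc (0 : ℝ) 1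

open Classical in
/-- The index of the piece that contains a given point of `Ĉ₀ ∪ Ĉ₁ ∪ Ĉ₂`. -/
def symbol (p : ℝ × ℝ) : Fin 3 := if p ∈ S.cube 0 then 0 else if p ∈ S.cube 1 then 1 else 2

/-- The skew product `F(x̂, x) = (Φ x̂, fᵢ x)` for `(x̂, x) ∈ Ĉᵢ × [0,1]`; its values outside
`S.dom` play no role. -/
def F (X : (ℝ × ℝ) × ℝ) : (ℝ × ℝ) × ℝ := (S.Φ X.1, S.f (S.symbol X.1) X.2)

/-- The maximal `F`-invariant set `Λ = ⋂_{n ∈ ℤ} Fⁿ([0,1]³)`: the points through which there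
passes a two-sided `F`-orbit in the domain of `F`. -/
def Λ : Set ((ℝ × ℝ) × ℝ) :=
  {X | ∃ o : ℤ → (ℝ × ℝ) × ℝ, o 0 = X ∧ ∀ n, o n ∈ S.dom ∧ S.F (o n) = o (n + 1)}

theorem mapsTo_Λ : MapsTo S.F S.Λ S.Λ := by
  rintro X ⟨o, rfl, ho⟩
  refine ⟨fun n => o (n + 1), ?_, fun n => ho (n + 1)⟩
  simpa using ((ho 0).2).symm

theorem fst_mem_Γ {X : (ℝ × ℝ) × ℝ} (hX : X ∈ S.Λ) : X.1 ∈ S.Γ := by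
  obtain ⟨o, rfl, ho⟩ := hX
  have hstep : ∀ n : ℤ, S.Φ (o n).1 = (o (n + 1)).1 := fun n => congrArg Prod.fst (ho n).2
  have key : ∀ n : ℤ, (S.Φ ^ n) (o 0).1 = (o n).1 := by
    intro n
    induction n using Int.induction_on with
    | zero => simp
    | succ k ih =>
      rw [add_comm, zpow_add, zpow_one, Equiv.Perm.mul_apply, ih, hstep, add_comm]
    | pred k ih =>
      apply S.Φ.injective
      rw [hstep, ← Equiv.Perm.mul_apply, ← zpow_one_add]
      simpa using ih
  intro n
  rw [key]
  exact (ho n).1.1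

/-- The restriction of `F` to `Λ`. -/
def FΛ : S.Λ → S.Λ := S.mapsTo_Λ.restrict _ _ _

/-- The semiconjugation `π : Λ → Σ₃`. -/
def π (X : S.Λ) : Seq3 := S.ϖ ⟨X.1.1, S.fst_mem_Γ X.2⟩

/-- `‖dF|_{E^c}‖` at `X`: the norm of the derivative of `F` along the central direction
`{0} × ℝ`, taken within the cube. -/
def centralNorm (X : (ℝ × ℝ) × ℝ) : ℝ :=
  ‖derivWithin (fun t : ℝ => S.F (X.1, t)) (Icc 0 1) X.2‖

/-- The central Lyapunov exponent `χ(μ) = ∫ log ‖dF|_{E^c}‖ dμ` of a measure on `Λ`. -/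
def χ (μ : Measure S.Λ) : ℝ := ∫ X, Real.log (S.centralNorm X.1) ∂μ

/-! ### Periodic fibre end points -/

/-- The fibre `I_{[ξ]}`: the intersection of `Λ` with the line `{ϖ⁻¹ ξ} × ℝ`. -/
def fibre (ξ : Seq3) : Set ℝ := {x | ((S.ϖ.symm ξ : ℝ × ℝ), x) ∈ S.Λ}

/-- The point `(ϖ⁻¹ ξ, p_ξ⁻)`, with `p_ξ⁻` the left end point of the fibre. -/
def leftEnd (ξ : Seq3) : (ℝ × ℝ) × ℝ := ((S.ϖ.symm ξ : ℝ × ℝ), sInf (S.fibre ξ))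

/-- The point `(ϖ⁻¹ ξ, p_ξ⁺)`, with `p_ξ⁺` the right end point of the fibre. -/
def rightEnd (ξ : Seq3) : (ℝ × ℝ) × ℝ := ((S.ϖ.symm ξ : ℝ × ℝ), sSup (S.fibre ξ))

/-- The words of length `m` in which the symbol `1` occurs; they correspond to the sequences of
(not necessarily least) period `m` in which the symbol `1` occurs. -/
def wordsWithOne (m : ℕ) : Finset (Fin m → Fin 3) := {w | ∃ j, w j = 1}

/-- The average of `½ (δ_{(ϖ⁻¹ ξ, p_ξ⁻)} + δ_{(ϖ⁻¹ ξ, p_ξ⁺)})` over all `m`-periodic sequences `ξ`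
in which the symbol `1` occurs. -/
def endpointMeasure (m : ℕ) [NeZero m] : Measure ((ℝ × ℝ) × ℝ) :=
  ((wordsWithOne m).card : ENNReal)⁻¹ • ∑ w ∈ wordsWithOne m,
    (2 : ENNReal)⁻¹ • (Measure.dirac (S.leftEnd (periodicSeq w)) +
      Measure.dirac (S.rightEnd (periodicSeq w)))

/-- `μ` is a weak accumulation point, as `m → ∞`, of the measures `S.endpointMeasure m`: it is the
weak limit of the subsequence of indices `m = φ k + 1`. -/
def IsWeakAccumulation (μ : Measure S.Λ) : Prop :=
  ∃ φ : ℕ → ℕ, StrictMono φ ∧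
    ∀ g : BoundedContinuousFunction ((ℝ × ℝ) × ℝ) ℝ,
      Tendsto (fun k => ∫ X, g X ∂(S.endpointMeasure (φ k + 1))) atTop
        (𝓝 (∫ X : S.Λ, g X.1 ∂μ))

end SkewSystem

/-! ### Measure-theoretic entropy -/

section Entropy

variable {α : Type*} [MeasurableSpace α]

/-- Shannon entropy of the finite partition into the level sets of `P`. -/
def partitionEntropy {ι : Type*} [Fintype ι] (μ : Measure α) (P : α → ι) : ℝ :=
  ∑ i, Real.negMulLog (μ.real (P ⁻¹' {i}))

/-- The partition `P ∨ T⁻¹P ∨ … ∨ T^{-(n-1)}P`. -/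
def refinedPartition {ι : Type*} (T : α → α) (P : α → ι) (n : ℕ) (x : α) : Fin n → ι :=
  fun j => P (T^[j] x)

/-- The Kolmogorov–Sinai entropy `h_μ(T)`: the supremum over the finite measurable partitions `P`
of the limit of `(1/n) H_μ(P ∨ … ∨ T^{-(n-1)}P)`. (For an invariant probability measure the limit
exists, so the upper limit is the limit.) -/
def entropy (T : α → α) (μ : Measure α) : EReal :=
  ⨆ (k : ℕ) (P : α → Fin k) (_ : Measurable P),
    limsup (fun n : ℕ => ((partitionEntropy μ (refinedPartition T P n) / n : ℝ) : EReal)) atTop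

end Entropy

end SkewHorseshoe

end

/-!
Everything about the skew product is read off in symbolic coordinates: a point of `Λ` is determined
by its itinerary `ξ = π X` and its fibre coordinate, on which `F` acts by the monotone map
`f_{ξ₀}`. The fibre over `ξ` is the nested intersection of the images of `[0,1]` under
`f_{ξ_{-1}} ∘ ⋯ ∘ f_{ξ_{-n}}` (`imageCore_subset_fibre`, `image_f_fibre`).

*Entropy.* Cut `Λ` according to the symbols at the times `-N, …, N` and the dyadic cell of the fibre
coordinate. Over a fixed itinerary the iterates are monotone in the fibre coordinate, so the number
of thresholds passed in `n` steps determines the `n`-name, and there are at most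
`3 ^ (n + 2 N + 1) (n 2 ^ N + 1)` names (`name_eq`, `ncard_names_le`). These partitions generate,
and a counting bound for a generating sequence bounds the entropy (`entropy_le_of_generating`): an
arbitrary partition is close to one with few names, and Gibbs' inequality, applied to the
distribution that picks a name uniformly and perturbs its letters independently, compares the
entropies (`partitionEntropy_refinedPartition_le`). Hence no invariant measure has entropy above
`log 3`, while the zeroth symbol alone gives `log 3` as soon as `π_* μ` is the Bernoulli measure.

*Exponent.* Let `ξ` be periodic and contain the symbol `1`. Since `f₁(1) = 0` and `1` is not in the
image of `f₁`, neither `0` nor `1` lies in the fibre over `ξ`. If the derivative of the orientation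
preserving return map at an end point `p` of the fibre were larger than `1`, an interval adjacent to
`p` outside the fibre would be covered by its own image, hence have preimages of all orders, hence
lie in the fibre (`deriv_return_le_one`). So the central exponent along these orbits is `≤ 0`, and
since `F` permutes the end points, the measures `μ_m` are invariant with exponent `≤ 0`. Both
properties pass to weak limits, because `log ‖dF|_{E^c}‖` is continuous on the compact set `Λ`. The
projections of the `μ_m` become equidistributed, as only `2 ^ m` of the `3 ^ m` words omit `1`
(`tendsto_average_wordsWithOne`). Limits exist by compactness of the space of probability measures.

*Ergodicity.* A limit is not known to be ergodic. The Bernoulli measure is ergodic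
(`ergodic_shift_bernoulli3`), so the invariant measures over it which minimise the exponent form a
nonempty compact face of the simplex of invariant measures, with exponent `≤ 0`. A strictly convex
continuous function attains its maximum over this face at an extreme point, which is an ergodic
measure (`exists_ergodic_of_face`).
-/

namespace SkewHorseshoe

/-! ### Entropy bounds from counting names -/

section EntropyBounds

variable {α : Type*} [MeasurableSpace α] {μ : Measure α}

/-- Gibbs' inequality. -/
theorem sum_negMulLog_le_of_sum_le_one {ι : Type*} [Fintype ι] {p q : ι → ℝ}
    (hp : ∀ i, 0 ≤ p i) (hp1 : ∑ i, p i = 1) (hq : ∀ i, 0 < q i) (hq1 : ∑ i, q i ≤ 1) :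
    ∑ i, Real.negMulLog (p i) ≤ ∑ i, p i * -Real.log (q i) := by
  have key : ∀ i, Real.negMulLog (p i) ≤ p i * -Real.log (q i) + (q i - p i) := by
    intro i
    rcases (hp i).eq_or_lt with h | h
    · simp [← h, (hq i).le]
    · have h1 := Real.log_le_sub_one_of_pos (div_pos (hq i) h)
      rw [Real.log_div (hq i).ne' h.ne'] at h1
      have h2 := mul_le_mul_of_nonneg_left h1 h.le
      have h3 : p i * (q i / p i - 1) = q i - p i := by field_simp
      rw [h3] at h2
      simp only [Real.negMulLog]
      linarith
  calc ∑ i, Real.negMulLog (p i) ≤ ∑ i, (p i * -Real.log (q i) + (q i - p i)) :=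
        Finset.sum_le_sum fun i _ => key i
    _ = ∑ i, p i * -Real.log (q i) + (∑ i, q i - ∑ i, p i) := by
        rw [Finset.sum_add_distrib, Finset.sum_sub_distrib]
    _ ≤ _ := by linarith

theorem partitionEntropy_le_integral [IsProbabilityMeasure μ] {ι : Type*} [Fintype ι]
    [MeasurableSpace ι] [MeasurableSingletonClass ι] {A : α → ι} (hA : Measurable A)
    {q : ι → ℝ} (hq : ∀ i, 0 < q i) (hq1 : ∑ i, q i ≤ 1) :
    partitionEntropy μ A ≤ ∫ x, -Real.log (q (A x)) ∂μ := by
  have : IsProbabilityMeasure (μ.map A) := Measure.isProbabilityMeasure_map hA.aemeasurable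
  have hr : ∀ i, μ.real (A ⁻¹' {i}) = (μ.map A).real {i} := fun i => by
    simp [Measure.real, Measure.map_apply hA (measurableSet_singleton i)]
  have h1 : ∑ i, (μ.map A).real {i} = 1 := by
    rw [sum_measureReal_singleton]; simp
  have h2 : ∫ x, -Real.log (q (A x)) ∂μ = ∫ i, -Real.log (q i) ∂(μ.map A) := by
    rw [integral_map hA.aemeasurable (measurable_of_finite _).aestronglyMeasurable]
  rw [h2, integral_fintype .of_finite]
  simp only [partitionEntropy, hr, smul_eq_mul]
  exact sum_negMulLog_le_of_sum_le_one (fun i => measureReal_nonneg) h1 hq hq1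

theorem measurable_refinedPartition {ι : Type*} [Fintype ι] [MeasurableSpace ι] {T : α → α}
    (hT : Measurable T) {P : α → ι} (hP : Measurable P) (n : ℕ) :
    Measurable (refinedPartition T P n) :=
  measurable_pi_iff.2 fun j => hP.comp (hT.iterate j)

/-- The entropy of the `n`-th refinement of `P` exceeds the logarithm of the number of `n`-names of
a second partition `P'` by at most `n` times a quantity that is small when `P` and `P'` rarely
differ. This is Gibbs' inequality for the distribution on `n`-names of `P` obtained by choosing an
`n`-name of `P'` uniformly and changing each of its letters independently with probability about
`ε`. -/
theorem partitionEntropy_refinedPartition_le [IsProbabilityMeasure μ] {T : α → α}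
    (hT : MeasurePreserving T μ μ) {k : ℕ} {P P' : α → Fin k} (hP : Measurable P)
    (hP' : Measurable P') {ε : ℝ} (hε : ε ∈ Ioo (0 : ℝ) 1) (n : ℕ) :
    partitionEntropy μ (refinedPartition T P n) ≤
      Real.log (range (refinedPartition T P' n)).ncard +
        n * (-Real.log (1 - ε) + μ.real {x | P x ≠ P' x} * -Real.log (ε / k)) := by
  classical
  have hne : Nonempty α := nonempty_of_isProbabilityMeasure μ
  have hk : 0 < k := (P hne.some).pos
  obtain ⟨hε0, hε1⟩ := hε
  set K : Fin k → Fin k → ℝ := fun b a => if a = b then 1 - ε else ε / k with hK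
  have hKpos : ∀ b a, 0 < K b a := by
    intro b a
    simp only [hK]
    split_ifs
    · linarith
    · positivity
  have hKsum : ∀ b, ∑ a, K b a ≤ 1 := by
    intro b
    have h1 : ∀ a, K b a ≤ (if a = b then 1 - ε else 0) + ε / k := by
      intro a
      simp only [hK]
      split_ifs
      · have : 0 ≤ ε / k := by positivity
        linarith
      · simp
    calc ∑ a, K b a ≤ ∑ a, ((if a = b then 1 - ε else 0) + ε / k) :=
          Finset.sum_le_sum fun a _ => h1 a
      _ = 1 := by
          rw [Finset.sum_add_distrib]
          simp
          field_simp
          ring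
  set B : Finset (Fin n → Fin k) := (range (refinedPartition T P' n)).toFinset with hB
  have hcard : (range (refinedPartition T P' n)).ncard = B.card := Set.ncard_eq_toFinset_card' _
  have hmemB : ∀ x, refinedPartition T P' n x ∈ B := fun x => by simp [hB]
  have hBpos : (0 : ℝ) < B.card := by
    exact_mod_cast Finset.card_pos.2 ⟨_, hmemB hne.some⟩
  set q : (Fin n → Fin k) → ℝ := fun a => (B.card : ℝ)⁻¹ * ∑ b ∈ B, ∏ j, K (b j) (a j) with hq
  have hqge : ∀ a, ∀ b ∈ B, (B.card : ℝ)⁻¹ * ∏ j, K (b j) (a j) ≤ q a := by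
    intro a b hb
    refine mul_le_mul_of_nonneg_left ?_ (by positivity)
    exact Finset.single_le_sum (f := fun b => ∏ j, K (b j) (a j))
      (fun b _ => Finset.prod_nonneg fun j _ => (hKpos _ _).le) hb
  have hprodpos : ∀ a b : Fin n → Fin k, 0 < ∏ j, K (b j) (a j) := fun a b =>
    Finset.prod_pos fun j _ => hKpos _ _
  have hqpos : ∀ a, 0 < q a := fun a =>
    lt_of_lt_of_le (mul_pos (inv_pos.2 hBpos) (hprodpos a _)) (hqge a _ (hmemB hne.some))
  have hqsum : ∑ a, q a ≤ 1 := by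
    rw [← Finset.mul_sum, Finset.sum_comm]
    have h1 : ∀ b ∈ B, ∑ a : Fin n → Fin k, ∏ j, K (b j) (a j) ≤ 1 := by
      intro b _
      rw [← Fintype.prod_sum]
      exact Finset.prod_le_one (fun j _ => Finset.sum_nonneg fun a _ => (hKpos _ _).le)
        fun j _ => hKsum _
    calc _ ≤ (B.card : ℝ)⁻¹ * ∑ b ∈ B, (1 : ℝ) := by gcongr with b hb; exact h1 b hb
      _ = 1 := by simp [hBpos.ne']
  -- the cost of a single letter
  set L : α → ℝ := fun x => -Real.log (1 - ε) + {x | P x ≠ P' x}.indicator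
    (fun _ => -Real.log (ε / k)) x with hL
  have hmeas : MeasurableSet {x | P x ≠ P' x} := (measurableSet_eq_fun hP hP').compl
  have hLint : Integrable L μ :=
    (integrable_const _).add ((integrable_const _).indicator hmeas)
  have hlog1 : 0 ≤ -Real.log (1 - ε) := by
    have := Real.log_nonpos (x := 1 - ε) (by linarith) (by linarith)
    linarith
  have hKL : ∀ x, -Real.log (K (P' x) (P x)) ≤ L x := by
    intro x
    by_cases h : P x = P' x
    · simp [hK, hL, h]
    · simp [hK, hL, h]
      linarith
  have hpt : ∀ x, -Real.log (q (refinedPartition T P n x)) ≤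
      Real.log B.card + ∑ j : Fin n, L (T^[j] x) := by
    intro x
    have h1 := Real.log_le_log (mul_pos (inv_pos.2 hBpos) (hprodpos _ _))
      (hqge (refinedPartition T P n x) _ (hmemB x))
    rw [Real.log_mul (inv_pos.2 hBpos).ne' (hprodpos _ _).ne', Real.log_inv,
      Real.log_prod fun j _ => (hKpos _ _).ne'] at h1
    have h2 : -∑ j : Fin n, Real.log (K (refinedPartition T P' n x j)
        (refinedPartition T P n x j)) ≤ ∑ j : Fin n, L (T^[j] x) := by
      rw [← Finset.sum_neg_distrib]
      exact Finset.sum_le_sum fun j _ => hKL _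
    linarith
  have hTj : ∀ j, MeasurePreserving T^[j] μ μ := fun j => hT.iterate j
  have hLj : ∀ j : ℕ, Integrable (fun x => L (T^[j] x)) μ := fun j =>
    (hTj j).integrable_comp_of_integrable hLint
  have hLjint : ∀ j : ℕ, ∫ x, L (T^[j] x) ∂μ = ∫ x, L x ∂μ := fun j => by
    have h1 : AEStronglyMeasurable L (μ.map T^[j]) := by
      rw [(hTj j).map_eq]; exact hLint.aestronglyMeasurable
    rw [← integral_map (hTj j).measurable.aemeasurable h1, (hTj j).map_eq]
  have hLval : ∫ x, L x ∂μ =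
      -Real.log (1 - ε) + μ.real {x | P x ≠ P' x} * -Real.log (ε / k) := by
    rw [hL, integral_add (integrable_const _) ((integrable_const _).indicator hmeas),
      integral_indicator_const _ hmeas]
    simp
  have hrm := measurable_refinedPartition hT.measurable hP n
  calc partitionEntropy μ (refinedPartition T P n)
      ≤ ∫ x, -Real.log (q (refinedPartition T P n x)) ∂μ :=
        partitionEntropy_le_integral hrm hqpos hqsum
    _ ≤ ∫ x, (Real.log B.card + ∑ j : Fin n, L (T^[j] x)) ∂μ := by
        refine integral_mono ?_ ?_ hpt
        · exact Integrable.comp_measurable (g := fun a => -Real.log (q a)) .of_finite hrm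
        · exact (integrable_const _).add (integrable_finsetSum _ fun j _ => hLj j)
    _ = _ := by
        have hsum : Integrable (fun x => ∑ j : Fin n, L (T^[j] x)) μ :=
          integrable_finsetSum _ fun j _ => hLj j
        rw [integral_add (integrable_const _) hsum, integral_finsetSum _ fun (j : Fin n) _ => hLj j]
        simp only [hLjint, hLval, hcard]
        simp
        ring

/-- If every finite partition can be approximated by partitions whose number of `n`-names has
exponential growth rate at most `h`, then the entropy is at most `h`. -/
theorem entropy_le_of_approx [IsProbabilityMeasure μ] {T : α → α}
    (hT : MeasurePreserving T μ μ) {h : ℝ}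
    (H : ∀ (k : ℕ) (P : α → Fin k), Measurable P → ∀ e : ℝ, 0 < e → ∃ P' : α → Fin k,
      Measurable P' ∧ μ.real {x | P x ≠ P' x} ≤ e ∧ ∀ δ : ℝ, 0 < δ → ∀ᶠ n : ℕ in atTop,
        Real.log (range (refinedPartition T P' n)).ncard ≤ n * (h + δ)) :
    entropy T μ ≤ (h : ℝ) := by
  refine iSup_le fun k => iSup_le fun P => iSup_le fun hP => ?_
  refine EReal.le_of_forall_lt_iff_le.1 fun z hz => ?_
  have hz' : h < z := by exact_mod_cast hz
  set δ := (z - h) / 3 with hδ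
  have hδ0 : 0 < δ := by simp only [hδ]; linarith
  -- `ε` makes the cost of a correct letter at most `δ`
  obtain ⟨ε, hε, hεδ⟩ : ∃ ε ∈ Ioo (0 : ℝ) 1, -Real.log (1 - ε) ≤ δ := by
    refine ⟨1 - Real.exp (-δ), ⟨?_, ?_⟩, ?_⟩
    · have := Real.exp_lt_one_iff.2 (neg_lt_zero.2 hδ0)
      linarith
    · have := Real.exp_pos (-δ)
      linarith
    · simp
  set c := |Real.log (ε / k)| + 1 with hc
  have hc0 : 0 < c := by positivity
  obtain ⟨P', hP', he, hn⟩ := H k P hP (δ / c) (by positivity)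
  have hcost : μ.real {x | P x ≠ P' x} * -Real.log (ε / k) ≤ δ := by
    calc μ.real {x | P x ≠ P' x} * -Real.log (ε / k)
        ≤ μ.real {x | P x ≠ P' x} * c := by
          refine mul_le_mul_of_nonneg_left ?_ measureReal_nonneg
          have := neg_abs_le (Real.log (ε / k))
          linarith
      _ ≤ δ / c * c := by gcongr
      _ = δ := by field_simp
  refine limsup_le_of_le (by isBoundedDefault) ?_
  filter_upwards [hn δ hδ0, eventually_gt_atTop 0] with n hn hn0
  have hn0' : (0 : ℝ) < n := by exact_mod_cast hn0
  rw [EReal.coe_le_coe_iff, div_le_iff₀ hn0']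
  have h1 := partitionEntropy_refinedPartition_le hT hP hP' hε n
  have h2 : n * (-Real.log (1 - ε) + μ.real {x | P x ≠ P' x} * -Real.log (ε / k)) ≤
      n * (δ + δ) := by gcongr
  have h3 : z * n = n * (h + δ) + n * (δ + δ) := by simp only [hδ]; ring
  linarith

/-- A sequence of finite partitions, each refining the previous ones, which together generate the
`σ`-algebra bounds the entropy by the largest of the growth rates of their numbers of `n`-names. -/
theorem entropy_le_of_generating [IsProbabilityMeasure μ] {T : α → α}
    (hT : MeasurePreserving T μ μ) {ι : ℕ → Type*} [∀ N, Fintype (ι N)]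
    (Q : ∀ N, α → ι N)
    (hQm : ∀ N s, MeasurableSet (Q N ⁻¹' s))
    (hQ : ∀ N M, N ≤ M → ∀ x y, Q M x = Q M y → Q N x = Q N y)
    (hgen : ‹MeasurableSpace α› = MeasurableSpace.generateFrom {A | ∃ N s, A = Q N ⁻¹' s})
    {h : ℝ} (hcount : ∀ N, ∀ δ : ℝ, 0 < δ → ∀ᶠ n : ℕ in atTop,
      Real.log (range (refinedPartition T (Q N) n)).ncard ≤ n * (h + δ)) :
    entropy T μ ≤ (h : ℝ) := by
  classical
  set 𝒜 : Set (Set α) := {A | ∃ N s, A = Q N ⁻¹' s} with h𝒜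
  have hpull : ∀ N M, N ≤ M → ∀ s, ∃ t, Q N ⁻¹' s = Q M ⁻¹' t := by
    intro N M hNM s
    refine ⟨Q M '' (Q N ⁻¹' s), ?_⟩
    ext x
    constructor
    · exact fun hx => ⟨x, hx, rfl⟩
    · rintro ⟨y, hy, hxy⟩
      have := hQ N M hNM y x hxy
      simpa [← this] using hy
  have halg : IsSetAlgebra 𝒜 := by
    refine ⟨⟨0, ∅, by simp⟩, ?_, ?_⟩
    · rintro _ ⟨N, s, rfl⟩
      exact ⟨N, sᶜ, rfl⟩
    · rintro _ _ ⟨N, s, rfl⟩ ⟨M, t, rfl⟩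
      obtain ⟨s', hs'⟩ := hpull N (max N M) (le_max_left _ _) s
      obtain ⟨t', ht'⟩ := hpull M (max N M) (le_max_right _ _) t
      exact ⟨max N M, s' ∪ t', by rw [hs', ht', preimage_union]⟩
  have hdense : μ.MeasureDense 𝒜 := 
    Measure.MeasureDense.of_generateFrom_isSetAlgebra_finite μ halg hgen
  refine entropy_le_of_approx hT fun k P hP e he => ?_
  have hne : Nonempty α := nonempty_of_isProbabilityMeasure μ
  have hk : 0 < k := (P hne.some).pos
  have hex : ∀ i : Fin k, ∃ A ∈ 𝒜, μ (symmDiff (P ⁻¹' {i}) A) < ENNReal.ofReal (e / k) := fun i =>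
    hdense.approx _ (hP (measurableSet_singleton i)) (measure_ne_top _ _) _ (by positivity)
  choose A hA hAe using hex
  choose N s hNs using hA
  obtain ⟨M, hM⟩ : ∃ M, ∀ i, N i ≤ M :=
    ⟨Finset.univ.sup N, fun i => Finset.le_sup (Finset.mem_univ i)⟩
  choose t ht using fun i => hpull (N i) M (hM i) (s i)
  have hAt : ∀ i, A i = Q M ⁻¹' t i := fun i => by rw [hNs, ht]
  -- an index whose approximating set contains the point, if there is one
  set φ : ι M → Fin k := fun a => if h : ∃ i, a ∈ t i then h.choose else ⟨0, hk⟩ with hφ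
  refine ⟨φ ∘ Q M, ?_, ?_, ?_⟩
  · exact fun s _ => hQm M (φ ⁻¹' s)
  · have hsub : {x | P x ≠ (φ ∘ Q M) x} ⊆ ⋃ i, symmDiff (P ⁻¹' {i}) (A i) := by
      intro x hx
      by_contra hcon
      simp only [mem_iUnion, not_exists, mem_symmDiff, mem_preimage, mem_singleton_iff, hAt,
        not_or, not_and, not_not] at hcon
      apply hx
      have h1 : Q M x ∈ t (P x) := (hcon (P x)).1 rfl
      have h2 : ∃ i, Q M x ∈ t i := ⟨_, h1⟩
      simp only [hφ, Function.comp_apply, dif_pos h2]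
      exact (hcon _).2 h2.choose_spec
    calc μ.real {x | P x ≠ (φ ∘ Q M) x}
        ≤ μ.real (⋃ i, symmDiff (P ⁻¹' {i}) (A i)) := measureReal_mono hsub (measure_ne_top _ _)
      _ ≤ ∑ i, μ.real (symmDiff (P ⁻¹' {i}) (A i)) := measureReal_iUnion_fintype_le _
      _ ≤ ∑ i : Fin k, e / k := by
          refine Finset.sum_le_sum fun i _ => ?_
          exact ENNReal.toReal_le_of_le_ofReal (by positivity) (hAe i).le
      _ = e := by
          simp
          field_simp
  · intro δ hδ
    filter_upwards [hcount M δ hδ] with n hn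
    refine le_trans ?_ hn
    have himg : range (refinedPartition T (φ ∘ Q M) n) ⊆
        (fun a j => φ (a j)) '' range (refinedPartition T (Q M) n) := by
      rintro _ ⟨x, rfl⟩
      exact ⟨_, ⟨x, rfl⟩, rfl⟩
    have hle : (range (refinedPartition T (φ ∘ Q M) n)).ncard ≤
        (range (refinedPartition T (Q M) n)).ncard :=
      (Set.ncard_le_ncard himg (Set.toFinite _)).trans (Set.ncard_image_le (Set.toFinite _))
    have hpos : 0 < (range (refinedPartition T (φ ∘ Q M) n)).ncard :=
      (Set.ncard_pos (Set.toFinite _)).2 ⟨_, mem_range_self hne.some⟩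
    exact Real.log_le_log (by exact_mod_cast hpos) (by exact_mod_cast hle)

/-- If all refinements of a partition into `k` pieces are equidistributed, the entropy is at least
`log k`. -/
theorem le_entropy_of_equidistributed {T : α → α} {k : ℕ} (hk : 0 < k) {P : α → Fin k}
    (hP : Measurable P)
    (h : ∀ n (a : Fin n → Fin k), μ.real (refinedPartition T P n ⁻¹' {a}) = ((k : ℝ)⁻¹) ^ n) :
    (Real.log k : ℝ) ≤ entropy T μ := by
  refine le_trans ?_ (le_iSup_of_le k (le_iSup_of_le P (le_iSup_of_le hP le_rfl)))
  have hk0 : (k : ℝ) ≠ 0 := by positivity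
  have hval : ∀ n : ℕ, partitionEntropy μ (refinedPartition T P n) = n * Real.log k := by
    intro n
    simp only [partitionEntropy, h, Real.negMulLog, Real.log_pow, Real.log_inv]
    simp only [Finset.sum_const, Finset.card_univ, Fintype.card_fun, Fintype.card_fin, nsmul_eq_mul]
    push_cast
    rw [inv_pow]
    field_simp
  refine le_limsup_of_le (by isBoundedDefault) fun b hb => ?_
  obtain ⟨n, hn, hn0⟩ := (hb.and (eventually_gt_atTop 0)).exists
  rw [hval] at hn
  have hn0' : (n : ℝ) ≠ 0 := by positivity
  rwa [mul_div_cancel_left₀ _ hn0'] at hn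

end EntropyBounds

/-! ### The maximal invariant set -/

/-- The `k`-th power of the shift, for `k : ℤ`. -/
def shiftBy (k : ℤ) (ξ : Seq3) : Seq3 := fun n => ξ (n + k)

theorem shiftBy_zero (ξ : Seq3) : shiftBy 0 ξ = ξ := by ext n; simp [shiftBy]

theorem shiftBy_shiftBy (j k : ℤ) (ξ : Seq3) : shiftBy j (shiftBy k ξ) = shiftBy (j + k) ξ := by
  ext n; simp [shiftBy, add_assoc]

theorem shift_shiftBy (k : ℤ) (ξ : Seq3) : shift (shiftBy k ξ) = shiftBy (k + 1) ξ := by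
  ext n; simp only [shift, shiftBy]; congr 2; ring

theorem shiftBy_shift (k : ℤ) (ξ : Seq3) : shiftBy k (shift ξ) = shiftBy (k + 1) ξ :=
  shiftBy_shiftBy k 1 ξ

theorem iterate_shift (n : ℕ) (ξ : Seq3) : shift^[n] ξ = shiftBy n ξ := by
  induction n with
  | zero => simp [shiftBy_zero]
  | succ n ih => rw [Function.iterate_succ_apply', ih, shift_shiftBy]; push_cast; rfl

theorem shift_injective : Function.Injective shift := by
  intro ξ η h
  ext n
  have := congrFun h (n - 1)
  simp only [shift, sub_add_cancel] at this
  rw [this]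

theorem continuous_shift : Continuous shift := continuous_pi fun n => continuous_apply (n + 1)

theorem measurable_shift : Measurable shift :=
  measurable_pi_iff.2 fun n => measurable_pi_apply (n + 1)

namespace SkewSystem

variable (S : SkewSystem)

theorem Φ_symm_eq (ξ : Seq3) : S.Φ (S.ϖ.symm ξ) = S.ϖ.symm (shift ξ) := by
  have h := S.conj (S.ϖ.symm ξ)
  rw [Homeomorph.apply_symm_apply] at h
  rw [← h, Homeomorph.symm_apply_apply]
  rfl

theorem symbol_symm (ξ : Seq3) : S.symbol (S.ϖ.symm ξ) = ξ 0 := by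
  have h : ∀ i, ((S.ϖ.symm ξ : ℝ × ℝ)) ∈ S.cube i ↔ ξ 0 = i := fun i => by
    rw [S.coding, Homeomorph.apply_symm_apply]
  simp only [symbol, h]
  generalize ξ 0 = a
  fin_cases a <;> simp

theorem symm_mem_iUnion_cube (ξ : Seq3) : (S.ϖ.symm ξ : ℝ × ℝ) ∈ ⋃ i, S.cube i :=
  (S.ϖ.symm ξ).2 0

theorem F_symm (ξ : Seq3) (x : ℝ) :
    S.F (S.ϖ.symm ξ, x) = ((S.ϖ.symm (shift ξ) : ℝ × ℝ), S.f (ξ 0) x) := by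
  simp only [F, symbol_symm, Φ_symm_eq]

variable {S}

theorem snd_mem (X : S.Λ) : X.1.2 ∈ Icc (0 : ℝ) 1 := by
  obtain ⟨X, o, rfl, ho⟩ := X
  exact (ho 0).1.2

theorem symm_π (X : S.Λ) : (S.ϖ.symm (S.π X) : ℝ × ℝ) = X.1.1 := by
  simp [π]

theorem val_eq (X : S.Λ) : X.1 = ((S.ϖ.symm (S.π X) : ℝ × ℝ), X.1.2) := by
  rw [symm_π]

theorem FΛ_val (X : S.Λ) :
    (S.FΛ X).1 = ((S.ϖ.symm (shift (S.π X)) : ℝ × ℝ), S.f (S.π X 0) X.1.2) := by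
  rw [← F_symm, ← val_eq]
  rfl

theorem π_FΛ (X : S.Λ) : S.π (S.FΛ X) = shift (S.π X) := by
  have h : (S.ϖ.symm (S.π (S.FΛ X)) : ℝ × ℝ) = S.ϖ.symm (shift (S.π X)) := by
    rw [symm_π, FΛ_val]
  exact S.ϖ.symm.injective (Subtype.ext h)

theorem FΛ_snd (X : S.Λ) : (S.FΛ X).1.2 = S.f (S.π X 0) X.1.2 := by rw [FΛ_val]

theorem ext_Λ {X Y : S.Λ} (h1 : S.π X = S.π Y) (h2 : X.1.2 = Y.1.2) : X = Y :=
  Subtype.ext (by rw [val_eq X, val_eq Y, h1, h2])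

/-- The point of `Λ` with given itinerary and given fibre coordinate. -/
def point (ξ : Seq3) {x : ℝ} (hx : x ∈ S.fibre ξ) : S.Λ := ⟨((S.ϖ.symm ξ : ℝ × ℝ), x), hx⟩

theorem π_point (ξ : Seq3) {x : ℝ} (hx : x ∈ S.fibre ξ) : S.π (point ξ hx) = ξ := by
  simp [π, point]

theorem mem_fibre (X : S.Λ) : X.1.2 ∈ S.fibre (S.π X) := by
  simp only [fibre, mem_ofPred_eq, ← val_eq, X.2]

theorem fibre_subset (ξ : Seq3) : S.fibre ξ ⊆ Icc 0 1 := fun _ hx => snd_mem (point ξ hx)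

theorem π_iterate_FΛ (n : ℕ) (X : S.Λ) : S.π (S.FΛ^[n] X) = shiftBy n (S.π X) := by
  induction n with
  | zero => simp [shiftBy_zero]
  | succ n ih => rw [Function.iterate_succ_apply', π_FΛ, ih, shift_shiftBy]; push_cast; rfl

/-- A set that `F` maps onto itself is contained in the maximal invariant set. -/
theorem mem_Λ_of_image_eq {K : Set ((ℝ × ℝ) × ℝ)} (hK : K ⊆ S.dom) (h1 : MapsTo S.F K K)
    (h2 : SurjOn S.F K K) {X : (ℝ × ℝ) × ℝ} (hX : X ∈ K) : X ∈ S.Λ := by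
  choose! p hpK hp using fun X (hX : X ∈ K) => h2 hX
  have hb : ∀ n : ℕ, p^[n] X ∈ K := fun n => by
    induction n with
    | zero => exact hX
    | succ n ih => rw [Function.iterate_succ_apply']; exact hpK _ ih
  have hf : ∀ n : ℕ, S.F^[n] X ∈ K := fun n => by
    induction n with
    | zero => exact hX
    | succ n ih => rw [Function.iterate_succ_apply']; exact h1 ih
  refine ⟨fun n => match n with
    | Int.ofNat n => S.F^[n] X
    | Int.negSucc n => p^[n + 1] X, rfl, fun n => ?_⟩
  match n with
  | Int.ofNat n => exact ⟨hK (hf n), (Function.iterate_succ_apply' S.F n X).symm⟩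
  | Int.negSucc 0 => exact ⟨hK (hb 1), hp _ (hb 0)⟩
  | Int.negSucc (n + 1) =>
    refine ⟨hK (hb (n + 2)), ?_⟩
    have h := hp _ (hb (n + 1))
    rw [← Function.iterate_succ_apply' p] at h
    exact h

/-! ### Compositions of fibre maps -/

variable (S)

/-- The composition `f_{ξ_{n-1}} ∘ ⋯ ∘ f_{ξ_0}`. -/
def comp (ξ : Seq3) : ℕ → ℝ → ℝ
  | 0, x => x
  | n + 1, x => S.f (ξ n) (comp ξ n x)

theorem comp_succ (ξ : Seq3) (n : ℕ) (x : ℝ) :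
    S.comp ξ (n + 1) x = S.f (ξ n) (S.comp ξ n x) := rfl

theorem comp_add (ξ : Seq3) (m n : ℕ) (x : ℝ) :
    S.comp ξ (m + n) x = S.comp (shiftBy m ξ) n (S.comp ξ m x) := by
  induction n with
  | zero => rfl
  | succ n ih =>
    rw [← add_assoc, comp_succ, comp_succ, ih]
    simp [shiftBy, add_comm]

theorem comp_mem (ξ : Seq3) (n : ℕ) {x : ℝ} (hx : x ∈ Icc (0 : ℝ) 1) :
    S.comp ξ n x ∈ Icc (0 : ℝ) 1 := by
  induction n with
  | zero => exact hx
  | succ n ih => exact S.mapsTo _ ih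

theorem continuousOn_comp (ξ : Seq3) (n : ℕ) : ContinuousOn (S.comp ξ n) (Icc 0 1) := by
  induction n with
  | zero => exact continuousOn_id
  | succ n ih => exact (S.contDiffOn _).continuousOn.comp ih fun x hx => S.comp_mem ξ n hx

theorem γ_pos : 0 < S.γ := S.f0_attracting.1.trans_le S.γ_ge

theorem strictMonoOn_or_strictAntiOn (i : Fin 3) :
    StrictMonoOn (S.f i) (Icc 0 1) ∨ StrictAntiOn (S.f i) (Icc 0 1) := by
  fin_cases i
  · exact Or.inl S.f0_increasing
  · refine Or.inr fun x hx y hy hxy => ?_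
    have := S.γ_pos
    have h1 := S.f1_eq x hx
    have h2 := S.f1_eq y hy
    show S.f 1 y < S.f 1 x
    rw [h1, h2]
    nlinarith
  · exact Or.inl S.f2_increasing

theorem strictMonoOn_or_strictAntiOn_comp (ξ : Seq3) (n : ℕ) :
    StrictMonoOn (S.comp ξ n) (Icc 0 1) ∨ StrictAntiOn (S.comp ξ n) (Icc 0 1) := by
  induction n with
  | zero => exact Or.inl fun _ _ _ _ h => h
  | succ n ih =>
    have hm : MapsTo (S.comp ξ n) (Icc 0 1) (Icc 0 1) := fun x hx => S.comp_mem ξ n hx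
    rcases ih with h | h <;> rcases S.strictMonoOn_or_strictAntiOn (ξ n) with h' | h'
    · exact Or.inl (h'.comp h hm)
    · exact Or.inr (h'.comp_strictMonoOn h hm)
    · exact Or.inr (h'.comp_strictAntiOn h hm)
    · exact Or.inl (h'.comp h hm)

theorem hasDerivWithinAt_f (i : Fin 3) {x : ℝ} (hx : x ∈ Icc (0 : ℝ) 1) :
    HasDerivWithinAt (S.f i) (dIcc (S.f i) x) (Icc 0 1) x :=
  ((S.contDiffOn i).differentiableOn one_ne_zero x hx).hasDerivWithinAt

theorem hasDerivWithinAt_comp (ξ : Seq3) (n : ℕ) {x : ℝ} (hx : x ∈ Icc (0 : ℝ) 1) :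
    HasDerivWithinAt (S.comp ξ n) (∏ j ∈ Finset.range n, dIcc (S.f (ξ j)) (S.comp ξ j x))
      (Icc 0 1) x := by
  induction n with
  | zero =>
    rw [Finset.range_zero, Finset.prod_empty]
    exact hasDerivWithinAt_id x _
  | succ n ih =>
    rw [Finset.prod_range_succ, mul_comm]
    exact (S.hasDerivWithinAt_f (ξ n) (S.comp_mem ξ n hx)).comp x ih
      fun y hy => S.comp_mem ξ n hy

variable {S}

theorem iterate_FΛ_snd (n : ℕ) (X : S.Λ) : (S.FΛ^[n] X).1.2 = S.comp (S.π X) n X.1.2 := by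
  induction n with
  | zero => rfl
  | succ n ih =>
    rw [Function.iterate_succ_apply', FΛ_snd, ih, π_iterate_FΛ, comp_succ]
    simp [shiftBy]

/-! ### Fibres -/

variable (S) in
/-- The points of `[0,1]` that have a preimage in `[0,1]` under `f_{ξ_{-1}} ∘ ⋯ ∘ f_{ξ_{-n}}` for
every `n`. By injectivity of the fibre maps this is the fibre of `Λ` over `ξ`. -/
def imageCore (ξ : Seq3) : Set ℝ := ⋂ n : ℕ, S.comp (shiftBy (-n) ξ) n '' Icc 0 1

theorem imageCore_subset_Icc (ξ : Seq3) : S.imageCore ξ ⊆ Icc 0 1 := by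
  intro x hx
  obtain ⟨y, hy, rfl⟩ := mem_iInter.1 hx 0
  exact hy

theorem antitone_image_comp (ξ : Seq3) :
    Antitone fun n : ℕ => S.comp (shiftBy (-n) ξ) n '' Icc 0 1 := by
  refine antitone_nat_of_succ_le fun n => ?_
  rintro _ ⟨y, hy, rfl⟩
  refine ⟨S.comp (shiftBy (-(n + 1 : ℕ)) ξ) 1 y, S.comp_mem _ _ hy, ?_⟩
  rw [show n + 1 = 1 + n by ring, comp_add, shiftBy_shiftBy]
  congr 2
  push_cast
  ring

theorem nonempty_imageCore (ξ : Seq3) : (S.imageCore ξ).Nonempty := by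
  have hc : ∀ n : ℕ, IsCompact (S.comp (shiftBy (-n) ξ) n '' Icc 0 1) := fun n =>
    isCompact_Icc.image_of_continuousOn (S.continuousOn_comp _ _)
  exact IsCompact.nonempty_iInter_of_sequence_nonempty_isCompact_isClosed _
    (fun n => antitone_image_comp ξ n.le_succ)
    (fun n => (nonempty_Icc.2 zero_le_one).image _) (hc 0) fun n => (hc n).isClosed

theorem f_mem_imageCore {ξ : Seq3} {x : ℝ} (hx : x ∈ S.imageCore ξ) :
    S.f (ξ 0) x ∈ S.imageCore (shift ξ) := by
  refine mem_iInter.2 fun n => antitone_image_comp (shift ξ) n.le_succ ?_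
  obtain ⟨y, hy, hyx⟩ := mem_iInter.1 hx n
  refine ⟨y, hy, ?_⟩
  rw [shiftBy_shift, comp_succ]
  have h1 : -((n + 1 : ℕ) : ℤ) + 1 = -n := by push_cast; ring
  rw [h1, hyx]
  simp [shiftBy]

theorem exists_mem_imageCore_f_eq {ξ : Seq3} {x : ℝ} (hx : x ∈ S.imageCore (shift ξ)) :
    ∃ y ∈ S.imageCore ξ, S.f (ξ 0) y = x := by
  have key : ∀ n : ℕ, ∃ z ∈ S.comp (shiftBy (-n) ξ) n '' Icc 0 1, S.f (ξ 0) z = x := by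
    intro n
    obtain ⟨y, hy, hyx⟩ := mem_iInter.1 hx (n + 1)
    rw [shiftBy_shift, comp_succ, show -((n + 1 : ℕ) : ℤ) + 1 = -n by push_cast; ring] at hyx
    refine ⟨_, ⟨y, hy, rfl⟩, ?_⟩
    rw [← hyx]
    simp [shiftBy]
  choose z hz hzx using key
  have hIcc : ∀ n, z n ∈ Icc (0 : ℝ) 1 := fun n => by
    obtain ⟨y, hy, h⟩ := hz n
    rw [← h]
    exact S.comp_mem _ _ hy
  refine ⟨z 0, mem_iInter.2 fun n => ?_, hzx 0⟩
  rw [S.injOn _ (hIcc 0) (hIcc n) ((hzx 0).trans (hzx n).symm)]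
  exact hz n

theorem imageCore_subset_fibre (ξ : Seq3) : S.imageCore ξ ⊆ S.fibre ξ := by
  intro x hx
  refine mem_Λ_of_image_eq
    (K := {X | ∃ ξ, X.1 = (S.ϖ.symm ξ : ℝ × ℝ) ∧ X.2 ∈ S.imageCore ξ}) ?_ ?_ ?_ ⟨ξ, rfl, hx⟩
  · rintro ⟨_, x⟩ ⟨ξ, rfl, hx⟩
    exact ⟨S.symm_mem_iUnion_cube ξ, imageCore_subset_Icc ξ hx⟩
  · rintro ⟨_, x⟩ ⟨ξ, rfl, hx⟩
    exact ⟨shift ξ, by rw [F_symm], by rw [F_symm]; exact f_mem_imageCore hx⟩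
  · rintro ⟨_, x⟩ ⟨ξ, rfl, hx⟩
    have hξ : shift (shiftBy (-1) ξ) = ξ := by rw [shift_shiftBy]; exact shiftBy_zero ξ
    dsimp only at hx
    rw [← hξ] at hx
    obtain ⟨y, hy, hyx⟩ := exists_mem_imageCore_f_eq hx
    exact ⟨((S.ϖ.symm (shiftBy (-1) ξ) : ℝ × ℝ), y), ⟨_, rfl, hy⟩, by rw [F_symm, hξ, hyx]⟩

theorem nonempty_fibre (ξ : Seq3) : (S.fibre ξ).Nonempty :=
  (nonempty_imageCore ξ).mono (imageCore_subset_fibre ξ)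

theorem exists_FΛ_eq (X : S.Λ) : ∃ Y : S.Λ, S.FΛ Y = X := by
  obtain ⟨X, o, rfl, ho⟩ := X
  refine ⟨⟨o (-1), fun n => o (n - 1), by simp, fun n => ?_⟩, ?_⟩
  · have := ho (n - 1)
    rwa [show n - 1 + 1 = n + 1 - 1 by ring] at this
  · exact Subtype.ext (ho (-1)).2

/-- The fibre maps carry fibres onto fibres. -/
theorem image_f_fibre (ξ : Seq3) : S.f (ξ 0) '' S.fibre ξ = S.fibre (shift ξ) := by
  ext x
  constructor
  · rintro ⟨y, hy, rfl⟩
    have h := mem_fibre (S.FΛ (point ξ hy))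
    rwa [π_FΛ, FΛ_snd, π_point] at h
  · intro hx
    obtain ⟨Y, hY⟩ := exists_FΛ_eq (point _ hx)
    have h1 : S.π Y = ξ := shift_injective (by rw [← π_FΛ, hY, π_point])
    have h2 := mem_fibre Y
    rw [h1] at h2
    refine ⟨_, h2, ?_⟩
    rw [← h1, ← FΛ_snd, hY]
    rfl

theorem image_comp_fibre (ξ : Seq3) (n : ℕ) :
    S.comp ξ n '' S.fibre ξ = S.fibre (shiftBy n ξ) := by
  induction n with
  | zero =>
    have : S.comp ξ 0 = id := rfl
    simp [this, shiftBy_zero]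
  | succ n ih =>
    have h1 : S.comp ξ (n + 1) = S.f (ξ n) ∘ S.comp ξ n := rfl
    have h2 : ξ n = shiftBy n ξ 0 := by simp [shiftBy]
    rw [h1, image_comp, ih, h2, image_f_fibre, shift_shiftBy]
    push_cast
    rfl

/-! ### Continuity and compactness -/

theorem continuous_π : Continuous S.π :=
  S.ϖ.continuous.comp (Continuous.subtype_mk (continuous_fst.comp continuous_subtype_val) _)

theorem continuous_comp_symbol {h : Fin 3 → ℝ → ℝ} (hh : ∀ i, ContinuousOn (h i) (Icc 0 1)) :
    Continuous fun X : S.Λ => h (S.π X 0) X.1.2 := by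
  have h1 : Continuous fun p : Fin 3 × Icc (0 : ℝ) 1 => h p.1 p.2 :=
    continuous_prod_of_discrete_left.2 fun i => (hh i).domRestrict
  have h2 : Continuous fun X : S.Λ => ((S.π X 0, ⟨X.1.2, snd_mem X⟩) : Fin 3 × Icc (0 : ℝ) 1) :=
    ((continuous_apply 0).comp continuous_π).prodMk
      (Continuous.subtype_mk (continuous_snd.comp continuous_subtype_val) _)
  exact h1.comp h2

theorem continuous_FΛ : Continuous S.FΛ := by
  refine continuous_induced_rng.2 ?_
  have h : Subtype.val ∘ S.FΛ = fun X : S.Λ =>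
      ((S.ϖ.symm (shift (S.π X)) : ℝ × ℝ), S.f (S.π X 0) X.1.2) := funext FΛ_val
  rw [h]
  exact (continuous_subtype_val.comp
    (S.ϖ.symm.continuous.comp (continuous_shift.comp continuous_π))).prodMk
    (continuous_comp_symbol fun i => (S.contDiffOn i).continuousOn)

theorem isCompact_Λ : IsCompact S.Λ := by
  -- `Λ` is a continuous image of the space of two-sided orbits in symbolic coordinates
  set O : Set (ℤ → Seq3 × Icc (0 : ℝ) 1) :=
    {o | ∀ n, shift (o n).1 = (o (n + 1)).1 ∧ S.f ((o n).1 0) (o n).2 = (o (n + 1)).2} with hO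
  have h1 : Continuous fun p : Fin 3 × Icc (0 : ℝ) 1 => S.f p.1 p.2 :=
    continuous_prod_of_discrete_left.2 fun i => (S.contDiffOn i).continuousOn.domRestrict
  have hclosed : IsClosed O := by
    simp only [hO, ofPred_forall, ofPred_and]
    refine isClosed_iInter fun n => IsClosed.inter (isClosed_eq ?_ ?_) (isClosed_eq ?_ ?_)
    · exact continuous_shift.comp (continuous_fst.comp (continuous_apply n))
    · exact continuous_fst.comp (continuous_apply (n + 1))
    · have h2 : Continuous fun o : ℤ → Seq3 × Icc (0 : ℝ) 1 => ((o n).1 0, (o n).2) :=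
        ((continuous_apply 0).comp (continuous_fst.comp (continuous_apply n))).prodMk
          (continuous_snd.comp (continuous_apply n))
      exact h1.comp h2
    · exact continuous_subtype_val.comp (continuous_snd.comp (continuous_apply (n + 1)))
  have himg : S.Λ = (fun o : ℤ → Seq3 × Icc (0 : ℝ) 1 =>
      ((S.ϖ.symm (o 0).1 : ℝ × ℝ), ((o 0).2 : ℝ))) '' O := by
    ext X
    constructor
    · rintro ⟨o, rfl, ho⟩
      have hmem : ∀ n, o n ∈ S.Λ := fun n => ⟨fun k => o (k + n), by simp, fun k => by
        have := ho (k + n)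
        rwa [add_right_comm] at this⟩
      have hstep : ∀ n, S.FΛ ⟨o n, hmem n⟩ = ⟨o (n + 1), hmem (n + 1)⟩ := fun n =>
        Subtype.ext (ho n).2
      refine ⟨fun n => (S.π ⟨o n, hmem n⟩, ⟨(o n).2, (ho n).1.2⟩), fun n => ⟨?_, ?_⟩, ?_⟩
      · rw [← π_FΛ, hstep]
      · dsimp only
        rw [← FΛ_snd ⟨o n, hmem n⟩, hstep]
      · exact (val_eq ⟨o 0, hmem 0⟩).symm
    · rintro ⟨o, ho, rfl⟩
      refine ⟨fun n => ((S.ϖ.symm (o n).1 : ℝ × ℝ), ((o n).2 : ℝ)), rfl, fun n => ⟨?_, ?_⟩⟩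
      · exact ⟨S.symm_mem_iUnion_cube _, (o n).2.2⟩
      · rw [F_symm, (ho n).1, (ho n).2]
  rw [himg]
  refine hclosed.isCompact.image ?_
  exact (continuous_subtype_val.comp (S.ϖ.symm.continuous.comp
    (continuous_fst.comp (continuous_apply 0)))).prodMk
    (continuous_subtype_val.comp (continuous_snd.comp (continuous_apply 0)))

instance : CompactSpace S.Λ := isCompact_iff_compactSpace.1 isCompact_Λ

instance : Nonempty S.Λ := ⟨point (fun _ => 0) (nonempty_fibre _).some_mem⟩

theorem isCompact_fibre (ξ : Seq3) : IsCompact (S.fibre ξ) := by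
  refine isCompact_Icc.of_isClosed_subset ?_ (fibre_subset ξ)
  exact isCompact_Λ.isClosed.preimage (Continuous.prodMk_right _)

theorem isLeast_sInf_fibre (ξ : Seq3) : IsLeast (S.fibre ξ) (sInf (S.fibre ξ)) :=
  (isCompact_fibre ξ).isLeast_sInf (nonempty_fibre ξ)

theorem isGreatest_sSup_fibre (ξ : Seq3) : IsGreatest (S.fibre ξ) (sSup (S.fibre ξ)) :=
  (isCompact_fibre ξ).isGreatest_sSup (nonempty_fibre ξ)

end SkewSystem

/-! ### The entropy of invariant measures -/

theorem ncard_range_le_card {α β γ : Type*} [Fintype β] [Finite γ] (f : α → γ) (g : α → β)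
    (h : ∀ x y, g x = g y → f x = f y) : (range f).ncard ≤ Fintype.card β := by
  classical
  rcases isEmpty_or_nonempty γ with hγ | hγ
  · have : range f = ∅ := Set.eq_empty_of_isEmpty _
    simp [this]
  have h1 : range f ⊆ (fun b => if h : ∃ x, g x = b then f h.choose else hγ.some) '' univ := by
    rintro _ ⟨x, rfl⟩
    refine ⟨g x, mem_univ _, ?_⟩
    have hx : ∃ y, g y = g x := ⟨x, rfl⟩
    simp only [dif_pos hx]
    exact h _ _ hx.choose_spec
  calc (range f).ncard ≤ _ := Set.ncard_le_ncard h1 (Set.toFinite _)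
    _ ≤ (univ : Set β).ncard := Set.ncard_image_le (Set.toFinite _)
    _ = Fintype.card β := by rw [Set.ncard_univ, Nat.card_eq_fintype_card]

theorem eventually_log_mul_add_one_le (K C : ℝ) (hK : 0 < K) {δ : ℝ} (hδ : 0 < δ) :
    ∀ᶠ n : ℕ in atTop, C + Real.log (n * K + 1) ≤ n * δ := by
  have h1 : Tendsto (fun n : ℕ => (n : ℝ) * K + 1) atTop atTop :=
    tendsto_atTop_add_const_right _ _ (tendsto_natCast_atTop_atTop.atTop_mul_const hK)
  have h2 := (h1.eventually (Real.isLittleO_log_id_atTop.bound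
    (show 0 < δ / (2 * K) by positivity)))
  have h3 : Tendsto (fun n : ℕ => (n : ℝ) * (δ / 2)) atTop atTop :=
    tendsto_natCast_atTop_atTop.atTop_mul_const (by positivity)
  filter_upwards [h2, h3.eventually_ge_atTop (C + δ / (2 * K))] with n h2 h3
  have h4 : (0 : ℝ) ≤ n * K + 1 := by positivity
  simp only [id, Real.norm_eq_abs, abs_of_nonneg h4] at h2
  have h5 := (le_abs_self _).trans h2
  have h6 : δ / (2 * K) * (n * K + 1) = n * (δ / 2) + δ / (2 * K) := by field_simp
  linarith

namespace SkewSystem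

variable {S : SkewSystem}

theorem comp_congr {ξ η : Seq3} {n : ℕ} (h : ∀ j < n, ξ j = η j) : S.comp ξ n = S.comp η n := by
  induction n with
  | zero => rfl
  | succ n ih =>
    ext x
    rw [comp_succ, comp_succ, ih fun j hj => h j (hj.trans n.lt_succ_self), h n n.lt_succ_self]

/-- The index of the dyadic cell of generation `N` that contains the fibre coordinate. -/
noncomputable def level (N : ℕ) (X : S.Λ) : ℕ := ⌊(2 : ℝ) ^ N * X.1.2⌋₊

/-- The `N`-th partition of `Λ`: the symbols at the times `-N, …, N`, together with the dyadic cell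
of generation `N` that contains the fibre coordinate. -/
noncomputable def cell (N : ℕ) (X : S.Λ) : (Finset.Icc (-N : ℤ) N → Fin 3) × Fin (2 ^ N + 1) :=
  (fun i => S.π X i, Fin.ofNat (2 ^ N + 1) (level N X))

theorem level_lt (N : ℕ) (X : S.Λ) : level N X < 2 ^ N + 1 := by
  have h : level N X ≤ 2 ^ N := by
    refine Nat.floor_le_of_le ?_
    have := (snd_mem X).2
    push_cast
    nlinarith [pow_pos (two_pos (α := ℝ)) N]
  omega

theorem cell_eq_iff {N : ℕ} {X Y : S.Λ} : cell N X = cell N Y ↔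
    (∀ i ∈ Finset.Icc (-N : ℤ) N, S.π X i = S.π Y i) ∧ level N X = level N Y := by
  simp only [cell, Prod.mk.injEq, funext_iff, Subtype.forall, Fin.ext_iff, Fin.val_ofNat,
    Nat.mod_eq_of_lt (level_lt N X), Nat.mod_eq_of_lt (level_lt N Y)]

theorem cell_eq_of_le {N M : ℕ} (hNM : N ≤ M) {X Y : S.Λ} (h : cell M X = cell M Y) :
    cell N X = cell N Y := by
  rw [cell_eq_iff] at h ⊢
  refine ⟨fun i hi => h.1 i ?_, ?_⟩
  · rw [Finset.mem_Icc] at hi ⊢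
    omega
  · have key : ∀ X : S.Λ, level N X = level M X / 2 ^ (M - N) := by
      intro X
      have h1 : (2 : ℝ) ^ N * X.1.2 = 2 ^ M * X.1.2 / (2 ^ (M - N) : ℕ) := by
        obtain ⟨d, rfl⟩ := Nat.exists_eq_add_of_le hNM
        rw [Nat.add_sub_cancel_left, pow_add]
        push_cast
        field_simp
      rw [level, h1, Nat.floor_div_natCast, level]
    rw [key, key, h.2]

theorem measurable_π : Measurable S.π := continuous_π.measurable

theorem measurable_cell (N : ℕ) : Measurable (cell (S := S) N) := by
  refine Measurable.prodMk (measurable_pi_iff.2 fun i => ?_) ?_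
  · exact (measurable_pi_apply _).comp measurable_π
  · refine (measurable_of_countable (Fin.ofNat (2 ^ N + 1))).comp (Nat.measurable_floor.comp ?_)
    exact (measurable_snd.comp measurable_subtype_coe).const_mul _

theorem continuous_symbolic : Continuous fun X : S.Λ => (S.π X, X.1.2) :=
  continuous_π.prodMk (continuous_snd.comp continuous_subtype_val)

theorem generateFrom_cell : (inferInstance : MeasurableSpace S.Λ) =
    MeasurableSpace.generateFrom {A | ∃ N s, A = cell (S := S) N ⁻¹' s} := by
  refine le_antisymm ?_ (MeasurableSpace.generateFrom_le ?_)
  · have hemb : IsClosedEmbedding fun X : S.Λ => (S.π X, X.1.2) :=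
      continuous_symbolic.isClosedEmbedding fun X Y h =>
        ext_Λ (Prod.ext_iff.1 h).1 (Prod.ext_iff.1 h).2
    rw [← hemb.measurableEmbedding.comap_eq]
    set m := MeasurableSpace.generateFrom {A | ∃ N s, A = cell (S := S) N ⁻¹' s} with hm
    have hcell : ∀ N s, MeasurableSet[m] (cell (S := S) N ⁻¹' s) := fun N s =>
      MeasurableSpace.measurableSet_generateFrom ⟨N, s, rfl⟩
    have h1 : Measurable[m] S.π := by
      refine measurable_pi_iff.2 fun n => ?_
      have h2 : (fun X : S.Λ => S.π X n) = (fun c : (Finset.Icc (-n.natAbs : ℤ) n.natAbs → Fin 3) ×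
          Fin (2 ^ n.natAbs + 1) => c.1 ⟨n, by rw [Finset.mem_Icc]; omega⟩) ∘ cell n.natAbs := rfl
      rw [h2]
      intro s _
      rw [preimage_comp]
      exact hcell _ _
    have h2 : Measurable[m] fun X : S.Λ => X.1.2 := by
      have hlim : ∀ X : S.Λ, Tendsto (fun N : ℕ => (level N X : ℝ) / 2 ^ N) atTop (𝓝 X.1.2) := by
        intro X
        have h3 := (tendsto_nat_floor_mul_div_atTop (R := ℝ) (snd_mem X).1).comp
          (tendsto_pow_atTop_atTop_of_one_lt (one_lt_two (α := ℝ)))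
        refine h3.congr fun N => ?_
        simp only [Function.comp_apply, level, mul_comm]
      refine @measurable_of_tendsto_metrizable _ _ m _ _ _ _ _ _ (fun N => ?_)
        (tendsto_pi_nhds.2 hlim)
      have h3 : (fun X : S.Λ => (level N X : ℝ) / 2 ^ N) =
          (fun c : (Finset.Icc (-N : ℤ) N → Fin 3) × Fin (2 ^ N + 1) => (c.2 : ℝ) / 2 ^ N) ∘
            cell N := by
        ext X
        simp only [Function.comp_apply, cell, Fin.val_ofNat, Nat.mod_eq_of_lt (level_lt N X)]
      rw [h3]
      intro s _
      rw [preimage_comp]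
      exact hcell _ _
    have h3 : Measurable[m] fun X : S.Λ => (S.π X, X.1.2) := h1.prodMk h2
    exact h3.comap_le
  · rintro _ ⟨N, s, rfl⟩
    exact measurable_cell N (Set.toFinite s).measurableSet

open Classical in
/-- The level thresholds passed by the first `n` iterates of the fibre coordinate, where for the
times at which the composed fibre map reverses orientation the thresholds that are *not* passed are
recorded. Over a fixed itinerary this set grows with the fibre coordinate. -/
noncomputable def passed (N n : ℕ) (X : S.Λ) : Finset (Fin n × Fin (2 ^ N)) :=
  {p | StrictMonoOn (S.comp (S.π X) p.1) (Icc 0 1) ↔ (p.2 : ℕ) + 1 ≤ level N (S.FΛ^[p.1] X)}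

/-- The `n`-name of a point is determined by its symbols at the times `-N, …, n + N` and by the
number of thresholds passed. -/
theorem name_eq {N n : ℕ} {X Y : S.Λ}
    (hπ : ∀ i ∈ Finset.Icc (-N : ℤ) (n + N), S.π X i = S.π Y i)
    (hc : (passed N n X).card = (passed N n Y).card) :
    refinedPartition S.FΛ (cell N) n X = refinedPartition S.FΛ (cell N) n Y := by
  wlog hXY : X.1.2 ≤ Y.1.2 generalizing X Y
  · exact (this (fun i hi => (hπ i hi).symm) hc.symm (le_of_not_ge hXY)).symm
  have hcomp : ∀ j : Fin n, S.comp (S.π X) j = S.comp (S.π Y) j := fun j =>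
    comp_congr fun i hi => hπ i (by rw [Finset.mem_Icc]; omega)
  have hsub : passed N n X ⊆ passed N n Y := by
    rintro ⟨j, c⟩ h
    simp only [passed, Finset.mem_filter, Finset.mem_univ, true_and, ← hcomp] at h ⊢
    by_cases hmono : StrictMonoOn (S.comp (S.π X) j) (Icc 0 1)
    · refine iff_of_true hmono ((h.1 hmono).trans (Nat.floor_mono ?_))
      rw [iterate_FΛ_snd, iterate_FΛ_snd, ← hcomp]
      exact mul_le_mul_of_nonneg_left (hmono.monotoneOn (snd_mem X) (snd_mem Y) hXY) (by positivity)
    · have hanti := (S.strictMonoOn_or_strictAntiOn_comp (S.π X) j).resolve_left hmono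
      refine iff_of_false hmono fun h' => hmono (h.2 (h'.trans (Nat.floor_mono ?_)))
      rw [iterate_FΛ_snd, iterate_FΛ_snd, ← hcomp]
      exact mul_le_mul_of_nonneg_left (hanti.antitoneOn (snd_mem X) (snd_mem Y) hXY)
        (by positivity)
  have heq := Finset.eq_of_subset_of_card_le hsub hc.ge
  ext1 j
  refine cell_eq_iff.2 ⟨fun i hi => ?_, ?_⟩
  · rw [π_iterate_FΛ, π_iterate_FΛ]
    refine hπ _ ?_
    rw [Finset.mem_Icc] at hi ⊢
    omega
  · have hiff : ∀ c : Fin (2 ^ N), (c : ℕ) + 1 ≤ level N (S.FΛ^[j] X) ↔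
        (c : ℕ) + 1 ≤ level N (S.FΛ^[j] Y) := by
      intro c
      have h := Finset.ext_iff.1 heq (j, c)
      simp only [passed, Finset.mem_filter, Finset.mem_univ, true_and, ← hcomp] at h
      tauto
    have hX := level_lt N (S.FΛ^[j] X)
    have hY := level_lt N (S.FΛ^[j] Y)
    by_contra hne
    rcases Nat.lt_or_gt_of_ne hne with h | h
    · have := (hiff ⟨level N (S.FΛ^[j] X), by omega⟩).2 h
      simp at this
    · have := (hiff ⟨level N (S.FΛ^[j] Y), by omega⟩).1 h
      simp at this

theorem ncard_names_le (N n : ℕ) : (range (refinedPartition S.FΛ (cell N) n)).ncard ≤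
    3 ^ (n + 2 * N + 1) * (n * 2 ^ N + 1) := by
  have hcard : ∀ X : S.Λ, (passed N n X).card < n * 2 ^ N + 1 := fun X => by
    have h := Finset.card_le_univ (passed N n X)
    simp only [Fintype.card_prod, Fintype.card_fin] at h
    omega
  have h := ncard_range_le_card (refinedPartition S.FΛ (cell (S := S) N) n)
    (fun X => ((fun i => S.π X i, ⟨_, hcard X⟩) :
      (Finset.Icc (-N : ℤ) (n + N) → Fin 3) × Fin (n * 2 ^ N + 1))) fun X Y hXY => by
        simp only [Prod.mk.injEq, funext_iff, Subtype.forall, Fin.mk.injEq] at hXY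
        exact name_eq hXY.1 hXY.2
  refine h.trans (le_of_eq ?_)
  simp only [Fintype.card_prod, Fintype.card_fun, Fintype.card_fin, Fintype.card_coe, Int.card_Icc]
  congr 2
  omega

/-- The fibre maps being monotone, the fibres carry no entropy, so that no invariant measure has
entropy larger than `log 3`. -/
theorem entropy_le_log_three {ν : Measure S.Λ} [IsProbabilityMeasure ν]
    (hν : MeasurePreserving S.FΛ ν ν) : entropy S.FΛ ν ≤ (Real.log 3 : ℝ) := by
  refine entropy_le_of_generating hν (fun N => cell N)
    (fun N s => measurable_cell N (Set.toFinite s).measurableSet)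
    (fun N M hNM X Y h => cell_eq_of_le hNM h) generateFrom_cell fun N δ hδ => ?_
  filter_upwards [eventually_log_mul_add_one_le (2 ^ N) ((2 * N + 1) * Real.log 3) (by positivity)
    hδ] with n hn
  have hpos : 0 < (range (refinedPartition S.FΛ (cell (S := S) N) n)).ncard :=
    (Set.ncard_pos (Set.toFinite _)).2 (range_nonempty _)
  calc Real.log (range (refinedPartition S.FΛ (cell (S := S) N) n)).ncard
      ≤ Real.log ((3 : ℝ) ^ (n + 2 * N + 1) * (n * 2 ^ N + 1)) := by
        refine Real.log_le_log (by exact_mod_cast hpos) ?_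
        exact_mod_cast ncard_names_le N n
    _ = n * Real.log 3 + ((2 * N + 1) * Real.log 3 + Real.log (n * 2 ^ N + 1)) := by
        rw [Real.log_mul (by positivity) (by positivity), Real.log_pow]
        push_cast
        ring
    _ ≤ _ := by linarith

end SkewSystem

instance : IsProbabilityMeasure bernoulli3 := by
  unfold bernoulli3; infer_instance

theorem bernoulli3_cylinder (n : ℕ) (a : Fin n → Fin 3) :
    bernoulli3 {ξ | ∀ j : Fin n, ξ j = a j} = 3⁻¹ ^ n := by
  have hinj : Function.Injective fun j : Fin n => ((j : ℕ) : ℤ) := fun i j h =>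
    Fin.ext (by exact Int.ofNat.inj h)
  have h := Measure.map_infinitePi_infinitePi_of_inj
    (P := fun _ : ℤ => (PMF.uniformOfFintype (Fin 3)).toMeasure) hinj
  have h2 : {ξ : Seq3 | ∀ j : Fin n, ξ j = a j} =
      (fun (ξ : Seq3) (j : Fin n) => ξ ((j : ℕ) : ℤ)) ⁻¹' {a} := by
    ext ξ
    simp [funext_iff]
  rw [h2, ← Measure.map_apply (by fun_prop) (measurableSet_singleton a), bernoulli3, h,
    Measure.infinitePi_singleton_of_fintype]
  simp

namespace SkewSystem

variable {S : SkewSystem}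

theorem entropy_eq_log_three {μ : Measure S.Λ} [IsProbabilityMeasure μ]
    (hμ : MeasurePreserving S.FΛ μ μ) (hπ : μ.map S.π = bernoulli3) :
    entropy S.FΛ μ = (Real.log 3 : ℝ) := by
  refine le_antisymm (entropy_le_log_three hμ) ?_
  have hP : Measurable fun X : S.Λ => S.π X 0 := (measurable_pi_apply 0).comp measurable_π
  have h := le_entropy_of_equidistributed (μ := μ) (T := S.FΛ) (k := 3) (by norm_num) hP
    fun n a => ?_
  · exact_mod_cast h
  · have h1 : refinedPartition S.FΛ (fun X => S.π X 0) n ⁻¹' {a} =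
        S.π ⁻¹' {ξ | ∀ j : Fin n, ξ j = a j} := by
      ext X
      simp [refinedPartition, funext_iff, π_iterate_FΛ, shiftBy]
    have h2 : MeasurableSet {ξ : Seq3 | ∀ j : Fin n, ξ j = a j} := by
      simp only [ofPred_forall]
      exact MeasurableSet.iInter fun j =>
        measurableSet_eq_fun (measurable_pi_apply _) measurable_const
    rw [h1, Measure.real, ← Measure.map_apply measurable_π h2, hπ, bernoulli3_cylinder]
    simp

end SkewSystem

/-! ### The central exponent along the end points of periodic fibres -/

theorem exists_lt_of_one_lt_deriv {g : ℝ → ℝ} {D p : ℝ} (hg : HasDerivWithinAt g D (Icc 0 1) p)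
    (hgp : g p = p) (hp : 0 < p) (hp1 : p ≤ 1) (hD : 1 < D) : ∃ y ∈ Ico 0 p, g y < y := by
  have h1 := (hasDerivWithinAt_iff_tendsto_slope' (s := Ico 0 p) (by simp)).1
    (hg.mono (Ico_subset_Icc_self.trans (Icc_subset_Icc_right hp1)))
  have : (𝓝[Ico 0 p] p).NeBot := by rw [nhdsWithin_Ico_eq_nhdsLT hp]; infer_instance
  obtain ⟨y, hy, hyI⟩ := ((h1.eventually (lt_mem_nhds hD)).and self_mem_nhdsWithin).exists
  refine ⟨y, hyI, ?_⟩
  rw [slope_def_field, hgp, one_lt_div_of_neg (by linarith [hyI.2])] at hy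
  linarith

theorem exists_gt_of_one_lt_deriv {g : ℝ → ℝ} {D p : ℝ} (hg : HasDerivWithinAt g D (Icc 0 1) p)
    (hgp : g p = p) (hp : 0 ≤ p) (hp1 : p < 1) (hD : 1 < D) : ∃ y ∈ Ioc p 1, y < g y := by
  have h1 := (hasDerivWithinAt_iff_tendsto_slope' (s := Ioc p 1) (by simp)).1
    (hg.mono (Ioc_subset_Icc_self.trans (Icc_subset_Icc_left hp)))
  have : (𝓝[Ioc p 1] p).NeBot := by rw [nhdsWithin_Ioc_eq_nhdsGT hp1]; infer_instance
  obtain ⟨y, hy, hyI⟩ := ((h1.eventually (lt_mem_nhds hD)).and self_mem_nhdsWithin).exists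
  refine ⟨y, hyI, ?_⟩
  rw [slope_def_field, hgp, one_lt_div (by linarith [hyI.1])] at hy
  linarith

namespace SkewSystem

variable {S : SkewSystem}

theorem centralNorm_eq (X : S.Λ) : S.centralNorm X.1 = |dIcc (S.f (S.π X 0)) X.1.2| := by
  have h1 : S.symbol X.1.1 = S.π X 0 := by rw [val_eq, symbol_symm]
  have h2 : HasDerivWithinAt (fun t : ℝ => S.F (X.1.1, t))
      ((0 : ℝ × ℝ), dIcc (S.f (S.π X 0)) X.1.2) (Icc 0 1) X.1.2 := by
    have h3 : (fun t : ℝ => S.F (X.1.1, t)) = fun t => (S.Φ X.1.1, S.f (S.π X 0) t) := by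
      ext1 t
      simp only [F, h1]
    rw [h3]
    exact (hasDerivWithinAt_const _ _ _).prodMk (S.hasDerivWithinAt_f _ (snd_mem X))
  rw [centralNorm, h2.derivWithin (uniqueDiffOn_Icc zero_lt_one _ (snd_mem X)), Prod.norm_def]
  simp

variable (S) in
/-- The logarithm of the central derivative. -/
noncomputable def logNorm (X : S.Λ) : ℝ := Real.log (S.centralNorm X.1)

theorem continuous_logNorm : Continuous S.logNorm := by
  have h : S.logNorm = fun X => Real.log |dIcc (S.f (S.π X 0)) X.1.2| := by
    ext X
    rw [logNorm, centralNorm_eq]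
  rw [h]
  refine continuous_comp_symbol (h := fun i x => Real.log |dIcc (S.f i) x|) fun i => ?_
  refine ContinuousOn.log ?_ fun x hx => abs_ne_zero.2 (S.deriv_ne_zero i x hx)
  exact ((S.contDiffOn i).continuousOn_derivWithin (uniqueDiffOn_Icc zero_lt_one) le_rfl).abs

theorem sum_logNorm_iterate (X : S.Λ) (n : ℕ) : ∑ j ∈ Finset.range n, S.logNorm (S.FΛ^[j] X) =
    Real.log |∏ j ∈ Finset.range n, dIcc (S.f (S.π X j)) (S.comp (S.π X) j X.1.2)| := by
  rw [Finset.abs_prod, Real.log_prod fun j _ =>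
    abs_ne_zero.2 (S.deriv_ne_zero _ _ (S.comp_mem _ _ (snd_mem X)))]
  refine Finset.sum_congr rfl fun j _ => ?_
  rw [logNorm, centralNorm_eq, iterate_FΛ_snd, π_iterate_FΛ]
  simp [shiftBy]

/-! ### The end points of a fibre -/

variable (S) in
/-- The point of `Λ` at the left end point of the fibre over `ξ`. -/
noncomputable def left (ξ : Seq3) : S.Λ := point ξ (isLeast_sInf_fibre ξ).1

variable (S) in
/-- The point of `Λ` at the right end point of the fibre over `ξ`. -/
noncomputable def right (ξ : Seq3) : S.Λ := point ξ (isGreatest_sSup_fibre ξ).1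

theorem eq_point {ξ : Seq3} {x : ℝ} (hx : x ∈ S.fibre ξ) {X : S.Λ} (h1 : S.π X = ξ)
    (h2 : X.1.2 = x) : X = point ξ hx :=
  ext_Λ (by rw [h1, π_point]) h2

/-- The end points of the fibres are permuted by `F`. -/
theorem FΛ_left_right (ξ : Seq3) :
    (S.FΛ (S.left ξ) = S.left (shift ξ) ∧ S.FΛ (S.right ξ) = S.right (shift ξ)) ∨
      (S.FΛ (S.left ξ) = S.right (shift ξ) ∧ S.FΛ (S.right ξ) = S.left (shift ξ)) := by
  have hl : S.π (S.FΛ (S.left ξ)) = shift ξ := by rw [π_FΛ, left, π_point]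
  have hr : S.π (S.FΛ (S.right ξ)) = shift ξ := by rw [π_FΛ, right, π_point]
  have hl2 : (S.FΛ (S.left ξ)).1.2 = S.f (ξ 0) (sInf (S.fibre ξ)) := by
    rw [FΛ_snd, left, π_point]; rfl
  have hr2 : (S.FΛ (S.right ξ)).1.2 = S.f (ξ 0) (sSup (S.fibre ξ)) := by
    rw [FΛ_snd, right, π_point]; rfl
  have hinf := isLeast_sInf_fibre (S := S) (shift ξ)
  have hsup := isGreatest_sSup_fibre (S := S) (shift ξ)
  rw [← image_f_fibre] at hinf hsup
  rcases S.strictMonoOn_or_strictAntiOn (ξ 0) with h | h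
  · have h' := h.monotoneOn.mono (fibre_subset (S := S) ξ)
    refine Or.inl ⟨eq_point _ hl ?_, eq_point _ hr ?_⟩
    · rw [hl2, ← image_f_fibre]
      exact (h'.map_isLeast (isLeast_sInf_fibre ξ)).unique hinf
    · rw [hr2, ← image_f_fibre]
      exact (h'.map_isGreatest (isGreatest_sSup_fibre ξ)).unique hsup
  · have h' := h.antitoneOn.mono (fibre_subset (S := S) ξ)
    refine Or.inr ⟨eq_point _ hl ?_, eq_point _ hr ?_⟩
    · rw [hl2, ← image_f_fibre]
      exact (h'.map_isLeast (isLeast_sInf_fibre ξ)).unique hsup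
    · rw [hr2, ← image_f_fibre]
      exact (h'.map_isGreatest (isGreatest_sSup_fibre ξ)).unique hinf

theorem add_FΛ_left_right (g : S.Λ → ℝ) (ξ : Seq3) :
    g (S.FΛ (S.left ξ)) + g (S.FΛ (S.right ξ)) = g (S.left (shift ξ)) + g (S.right (shift ξ)) := by
  rcases FΛ_left_right (S := S) ξ with ⟨h1, h2⟩ | ⟨h1, h2⟩
  · rw [h1, h2]
  · rw [h1, h2, add_comm]

theorem add_iterate_FΛ_left_right (g : S.Λ → ℝ) (ξ : Seq3) (n : ℕ) :
    g (S.FΛ^[n] (S.left ξ)) + g (S.FΛ^[n] (S.right ξ)) =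
      g (S.left (shift^[n] ξ)) + g (S.right (shift^[n] ξ)) := by
  induction n generalizing ξ with
  | zero => rfl
  | succ n ih =>
    have h := add_FΛ_left_right (fun X => g (S.FΛ^[n] X)) ξ
    simp only [← Function.iterate_succ_apply] at h
    rw [h, ih, Function.iterate_succ_apply]

/-! ### Fibres over itineraries with the symbol `1` in the distant past -/

theorem eq_one_of_f_eq_one {i : Fin 3} {y : ℝ} (hy : y ∈ Icc (0 : ℝ) 1) (h : S.f i y = 1) :
    i ≠ 1 ∧ y = 1 := by
  have h1 : (1 : ℝ) ∈ Icc (0 : ℝ) 1 := right_mem_Icc.2 zero_le_one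
  have key : StrictMonoOn (S.f i) (Icc 0 1) → y = 1 := fun hm =>
    hy.2.eq_of_not_lt fun hlt => by
      have h2 := hm hy h1 hlt
      have h3 := (S.mapsTo i h1).2
      linarith
  fin_cases i
  · exact ⟨by decide, key S.f0_increasing⟩
  · have h2 : S.γ * (1 - y) = 1 := (S.f1_eq y hy).symm.trans h
    have := S.γ_pos
    have := S.γ_lt_one
    have := hy.1
    nlinarith
  · exact ⟨by decide, key S.f2_increasing⟩

theorem eq_of_f_eq_zero {i : Fin 3} {y : ℝ} (hy : y ∈ Icc (0 : ℝ) 1) (h : S.f i y = 0) :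
    (i ≠ 1 ∧ y = 0) ∨ y = 1 := by
  have h0 : (0 : ℝ) ∈ Icc (0 : ℝ) 1 := left_mem_Icc.2 zero_le_one
  fin_cases i
  · refine Or.inl ⟨by decide, S.injOn 0 hy h0 (h.trans ?_)⟩
    exact ((S.f0_fixed 0 h0).2 (Or.inl rfl)).symm
  · have h2 : S.γ * (1 - y) = 0 := (S.f1_eq y hy).symm.trans h
    have h3 := (mul_eq_zero.1 h2).resolve_left S.γ_pos.ne'
    exact Or.inr (by linarith)
  · exact Or.inl ⟨by decide, S.injOn 2 hy h0 (h.trans S.f2_zero.symm)⟩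

theorem shift_shiftBy_neg (n : ℕ) (ξ : Seq3) :
    shift (shiftBy (-(n + 1 : ℕ)) ξ) = shiftBy (-n) ξ := by
  rw [shift_shiftBy]
  congr 1
  push_cast
  ring

theorem one_notMem_fibre {ξ : Seq3} {n : ℕ} (hξ : ξ (-(n + 1 : ℕ)) = 1) : (1 : ℝ) ∉ S.fibre ξ := by
  intro h
  have key : ∀ k : ℕ, (1 : ℝ) ∈ S.fibre (shiftBy (-k) ξ) ∧ ξ (-(k + 1 : ℕ)) ≠ 1 := by
    have step : ∀ k : ℕ, (1 : ℝ) ∈ S.fibre (shiftBy (-k) ξ) →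
        (1 : ℝ) ∈ S.fibre (shiftBy (-(k + 1 : ℕ)) ξ) ∧ ξ (-(k + 1 : ℕ)) ≠ 1 := by
      intro k hk
      rw [← shift_shiftBy_neg, ← image_f_fibre] at hk
      obtain ⟨y, hy, hy1⟩ := hk
      obtain ⟨h1, rfl⟩ := eq_one_of_f_eq_one (fibre_subset _ hy) hy1
      exact ⟨hy, by simpa [shiftBy] using h1⟩
    have hall : ∀ k : ℕ, (1 : ℝ) ∈ S.fibre (shiftBy (-k) ξ) := fun k => by
      induction k with
      | zero => simpa [shiftBy_zero] using h
      | succ k ih => exact (step k ih).1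
    exact fun k => ⟨hall k, (step k (hall k)).2⟩
  exact (key n).2 hξ

theorem zero_notMem_fibre {ξ : Seq3} (hξ : ∀ N : ℕ, ∃ n ≥ N, ξ (-(n + 1 : ℕ)) = 1) :
    (0 : ℝ) ∉ S.fibre ξ := by
  intro h
  have step : ∀ k : ℕ, (0 : ℝ) ∈ S.fibre (shiftBy (-k) ξ) →
      (0 : ℝ) ∈ S.fibre (shiftBy (-(k + 1 : ℕ)) ξ) ∧ ξ (-(k + 1 : ℕ)) ≠ 1 := by
    intro k hk
    rw [← shift_shiftBy_neg, ← image_f_fibre] at hk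
    obtain ⟨y, hy, hy0⟩ := hk
    rcases eq_of_f_eq_zero (fibre_subset _ hy) hy0 with ⟨h1, rfl⟩ | rfl
    · exact ⟨hy, by simpa [shiftBy] using h1⟩
    · obtain ⟨n, hn, hn1⟩ := hξ (k + 1)
      refine absurd hy (one_notMem_fibre (n := n - (k + 1)) ?_)
      rw [shiftBy, ← hn1]
      congr 1
      push_cast [Nat.cast_sub hn]
      ring
  have hall : ∀ k : ℕ, (0 : ℝ) ∈ S.fibre (shiftBy (-k) ξ) := fun k => by
    induction k with
    | zero => simpa [shiftBy_zero] using h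
    | succ k ih => exact (step k ih).1
  obtain ⟨n, -, hn⟩ := hξ 0
  exact (step n (hall n)).2 hn

theorem shiftBy_mul_eq {ξ : Seq3} {m : ℕ} (h : shiftBy m ξ = ξ) (k : ℕ) :
    shiftBy (k * m : ℕ) ξ = ξ := by
  induction k with
  | zero => simp [shiftBy_zero]
  | succ k ih =>
    rw [show ((k + 1) * m : ℕ) = (k * m : ℕ) + m by ring]
    push_cast at ih ⊢
    rw [← shiftBy_shiftBy, h, ih]

theorem shiftBy_neg_eq {ξ : Seq3} {m : ℤ} (h : shiftBy m ξ = ξ) : shiftBy (-m) ξ = ξ := by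
  conv_lhs => rw [← h, shiftBy_shiftBy, neg_add_cancel, shiftBy_zero]

theorem exists_past_eq_one {ξ : Seq3} {m : ℕ} (hm : 0 < m) (h : shiftBy m ξ = ξ) {j : ℤ}
    (hj : ξ j = 1) (N : ℕ) : ∃ n ≥ N, ξ (-(n + 1 : ℕ)) = 1 := by
  set k := j.natAbs + N + 1 with hk
  have h1 := congrFun (shiftBy_neg_eq (shiftBy_mul_eq h k)) j
  have h2 : (k : ℤ) ≤ (k * m : ℕ) := by exact_mod_cast Nat.le_mul_of_pos_right k hm
  refine ⟨((k * m : ℕ) - j - 1).toNat, by omega, ?_⟩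
  rw [← hj, ← h1, shiftBy]
  congr 1
  push_cast
  omega

/-! ### Return maps over periodic itineraries -/

/-- Over a periodic itinerary, a set covered by its own image under the return map lies in the
fibre. -/
theorem subset_fibre_of_subset_image {ξ : Seq3} {M : ℕ} (hM : 0 < M) (h : shiftBy M ξ = ξ)
    {J : Set ℝ} (hJ : J ⊆ Icc 0 1) (hJM : J ⊆ S.comp ξ M '' J) : J ⊆ S.fibre ξ := by
  have key : ∀ k : ℕ, J ⊆ S.comp ξ (k * M) '' J := by
    intro k
    induction k with
    | zero =>
      rw [zero_mul]
      exact fun x hx => ⟨x, hx, rfl⟩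
    | succ k ih =>
      intro x hx
      obtain ⟨y, hy, rfl⟩ := ih hx
      obtain ⟨z, hz, rfl⟩ := hJM hy
      refine ⟨z, hz, ?_⟩
      rw [show (k + 1) * M = M + k * M by ring, comp_add, h]
  refine fun x hx => imageCore_subset_fibre ξ (mem_iInter.2 fun n => ?_)
  have h1 := image_mono hJ (key n hx)
  have h2 := antitone_image_comp (S := S) ξ (Nat.le_mul_of_pos_right n hM)
  rw [← shiftBy_neg_eq (shiftBy_mul_eq h n)] at h1
  exact h2 h1

/-- An end point of the fibre attracts from outside the fibre under an orientation preserving return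
map, so that the derivative there is at most `1`. -/
theorem deriv_return_le_one {ξ : Seq3} {M : ℕ} (hM : 0 < M) (h : shiftBy M ξ = ξ)
    (hmono : StrictMonoOn (S.comp ξ M) (Icc 0 1)) (h0 : (0 : ℝ) ∉ S.fibre ξ)
    (h1 : (1 : ℝ) ∉ S.fibre ξ) {p : ℝ} (hp : p = sInf (S.fibre ξ) ∨ p = sSup (S.fibre ξ)) :
    |∏ j ∈ Finset.range M, dIcc (S.f (ξ j)) (S.comp ξ j p)| ≤ 1 := by
  have himg : S.comp ξ M '' S.fibre ξ = S.fibre ξ := by rw [image_comp_fibre, h]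
  have hmono' := hmono.monotoneOn.mono (fibre_subset (S := S) ξ)
  have hinf := isLeast_sInf_fibre (S := S) ξ
  have hsup := isGreatest_sSup_fibre (S := S) ξ
  have hpf : p ∈ S.fibre ξ := by
    rcases hp with rfl | rfl
    exacts [hinf.1, hsup.1]
  have hpI := fibre_subset ξ hpf
  have hD := S.hasDerivWithinAt_comp ξ M hpI
  set D := ∏ j ∈ Finset.range M, dIcc (S.f (ξ j)) (S.comp ξ j p) with hDdef
  have hD0 : 0 ≤ D := by
    rw [← hD.derivWithin (uniqueDiffOn_Icc zero_lt_one _ hpI)]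
    exact hmono.monotoneOn.derivWithin_nonneg
  have hp0 : 0 < p := hpI.1.lt_of_ne fun h' => h0 (h' ▸ hpf)
  have hp1 : p < 1 := hpI.2.lt_of_ne fun h' => h1 (h' ▸ hpf)
  rw [abs_of_nonneg hD0]
  by_contra! hlt
  rcases hp with hp | hp
  · have hfix : S.comp ξ M p = p := by
      have := hmono'.map_isLeast hinf
      rw [himg, ← hp] at this
      exact this.unique (hp ▸ hinf)
    obtain ⟨y, hy, hyg⟩ := exists_lt_of_one_lt_deriv hD hfix hp0 hpI.2 hlt
    have hJ : Icc y p ⊆ Icc (0 : ℝ) 1 := Icc_subset_Icc hy.1 hpI.2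
    have hcov : Icc y p ⊆ S.comp ξ M '' Icc y p := by
      refine Subset.trans ?_ (intermediate_value_Icc hy.2.le ((S.continuousOn_comp ξ M).mono hJ))
      rw [hfix]
      exact Icc_subset_Icc_left hyg.le
    have := subset_fibre_of_subset_image hM h hJ hcov (left_mem_Icc.2 hy.2.le)
    exact absurd (hinf.2 this) (not_le.2 (hp ▸ hy.2))
  · have hfix : S.comp ξ M p = p := by
      have := hmono'.map_isGreatest hsup
      rw [himg, ← hp] at this
      exact this.unique (hp ▸ hsup)
    obtain ⟨y, hy, hyg⟩ := exists_gt_of_one_lt_deriv hD hfix hpI.1 hp1 hlt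
    have hJ : Icc p y ⊆ Icc (0 : ℝ) 1 := Icc_subset_Icc hpI.1 hy.2
    have hcov : Icc p y ⊆ S.comp ξ M '' Icc p y := by
      refine Subset.trans ?_ (intermediate_value_Icc hy.1.le ((S.continuousOn_comp ξ M).mono hJ))
      rw [hfix]
      exact Icc_subset_Icc_right hyg.le
    have := subset_fibre_of_subset_image hM h hJ hcov (right_mem_Icc.2 hy.1.le)
    exact absurd (hsup.2 this) (not_le.2 (hp ▸ hy.1))

/-- Along the orbit of an end point of the fibre over a periodic itinerary in which `1` occurs, the
central exponent is not positive. -/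
theorem sum_logNorm_nonpos {ξ : Seq3} {m : ℕ} (hm : 0 < m) (h : shiftBy m ξ = ξ) {j : ℤ}
    (hj : ξ j = 1) {X : S.Λ} (hX : X = S.left ξ ∨ X = S.right ξ) :
    ∑ i ∈ Finset.range (m + m), S.logNorm (S.FΛ^[i] X) ≤ 0 := by
  have hpast := exists_past_eq_one hm h hj
  have hπ : S.π X = ξ := by rcases hX with rfl | rfl <;> exact π_point _ _
  have hp : X.1.2 = sInf (S.fibre ξ) ∨ X.1.2 = sSup (S.fibre ξ) := by
    rcases hX with rfl | rfl
    exacts [Or.inl rfl, Or.inr rfl]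
  -- twice the period, because the return map over one period may reverse orientation
  have h2 : shiftBy (m + m : ℕ) ξ = ξ := by
    push_cast
    rw [← shiftBy_shiftBy, h, h]
  have hmono : StrictMonoOn (S.comp ξ (m + m)) (Icc 0 1) := by
    have h3 : S.comp ξ (m + m) = S.comp ξ m ∘ S.comp ξ m := by
      ext x
      rw [comp_add, h]
      rfl
    have hmaps : MapsTo (S.comp ξ m) (Icc 0 1) (Icc 0 1) := fun x hx => S.comp_mem ξ m hx
    rw [h3]
    rcases S.strictMonoOn_or_strictAntiOn_comp ξ m with h4 | h4
    exacts [h4.comp h4 hmaps, h4.comp h4 hmaps]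
  obtain ⟨n, -, hn⟩ := hpast 0
  rw [sum_logNorm_iterate, hπ]
  exact Real.log_nonpos (abs_nonneg _) (deriv_return_le_one (by omega) h2 hmono
    (zero_notMem_fibre hpast) (one_notMem_fibre hn) hp)

end SkewSystem

/-! ### Counting periodic itineraries -/

/-- The residue of an integer modulo `m`, as an element of `Fin m`. -/
def residue (m : ℕ) [NeZero m] (n : ℤ) : Fin m := Fin.ofNat m (n % (m : ℤ)).toNat

theorem mem_wordsWithOne {m : ℕ} {w : Fin m → Fin 3} :
    w ∈ SkewSystem.wordsWithOne m ↔ ∃ j, w j = 1 := by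
  simp [SkewSystem.wordsWithOne]

theorem card_words_without_one {m : ℕ} :
    ((SkewSystem.wordsWithOne m)ᶜ).card = 2 ^ m := by
  have h : (SkewSystem.wordsWithOne m)ᶜ = Fintype.piFinset fun _ : Fin m => {0, 2} := by
    ext w
    simp only [Finset.mem_compl, mem_wordsWithOne, Fintype.mem_piFinset, not_exists]
    refine forall_congr' fun j => ?_
    generalize w j = a
    fin_cases a <;> simp
  rw [h, Fintype.card_piFinset]
  simp

theorem card_wordsWithOne {m : ℕ} : ((SkewSystem.wordsWithOne m).card : ℝ) = 3 ^ m - 2 ^ m := by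
  have h := Finset.card_add_card_compl (SkewSystem.wordsWithOne m)
  rw [card_words_without_one] at h
  simp only [Fintype.card_fun, Fintype.card_fin] at h
  have : ((SkewSystem.wordsWithOne m).card : ℝ) + 2 ^ m = 3 ^ m := by exact_mod_cast h
  linarith

section Words

variable {m : ℕ} [NeZero m]

theorem periodicSeq_apply (w : Fin m → Fin 3) (n : ℤ) : periodicSeq w n = w (residue m n) := rfl

theorem coe_residue (n : ℤ) : ((residue m n : ℕ) : ℤ) = n % m := by
  have hm : (0 : ℤ) < m := by exact_mod_cast NeZero.pos m
  have h1 := Int.emod_nonneg n hm.ne'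
  have h2 := Int.emod_lt_of_pos n hm
  rw [residue, Fin.val_ofNat, Nat.mod_eq_of_lt (by omega)]
  omega

theorem residue_add_one (n : ℤ) : residue m (n + 1) = residue m n + 1 := by
  apply Fin.ext
  have h : ((residue m (n + 1) : ℕ) : ℤ) = ((residue m n + 1 : Fin m) : ℕ) := by
    rw [Fin.val_add, Fin.val_one']
    push_cast
    rw [coe_residue, coe_residue, Int.add_emod]
  exact_mod_cast h

theorem residue_add_self (n : ℤ) : residue m (n + m) = residue m n := by
  simp [residue]

theorem residue_natCast (j : Fin m) : residue m ((j : ℕ) : ℤ) = j := by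
  apply Fin.ext
  have h := coe_residue (m := m) ((j : ℕ) : ℤ)
  rw [Int.emod_eq_of_lt (by positivity) (by exact_mod_cast j.2)] at h
  exact_mod_cast h

theorem shiftBy_periodicSeq (w : Fin m → Fin 3) : shiftBy m (periodicSeq w) = periodicSeq w := by
  ext n
  simp [shiftBy, periodicSeq_apply, residue_add_self]

theorem exists_periodicSeq_eq_one {w : Fin m → Fin 3} (hw : w ∈ SkewSystem.wordsWithOne m) :
    ∃ j : ℤ, periodicSeq w j = 1 := by
  obtain ⟨j, hj⟩ := mem_wordsWithOne.1 hw
  exact ⟨(j : ℕ), by rw [periodicSeq_apply, residue_natCast, hj]⟩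

theorem card_wordsWithOne_pos : 0 < (SkewSystem.wordsWithOne m).card :=
  Finset.card_pos.2 ⟨fun _ => 1, mem_wordsWithOne.2 ⟨0, rfl⟩⟩

variable (m) in
/-- The cyclic rotation of words of length `m`. -/
def rotate : (Fin m → Fin 3) ≃ (Fin m → Fin 3) :=
  (Equiv.addRight (1 : Fin m)).symm.arrowCongr (Equiv.refl _)

theorem rotate_apply (w : Fin m → Fin 3) (j : Fin m) : rotate m w j = w (j + 1) := rfl

theorem periodicSeq_rotate (w : Fin m → Fin 3) :
    periodicSeq (rotate m w) = shift (periodicSeq w) := by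
  ext n
  simp [shift, periodicSeq_apply, rotate_apply, residue_add_one]

theorem sum_wordsWithOne_shift (E : Seq3 → ℝ) :
    ∑ w ∈ SkewSystem.wordsWithOne m, E (shift (periodicSeq w)) =
      ∑ w ∈ SkewSystem.wordsWithOne m, E (periodicSeq w) := by
  refine Finset.sum_equiv (rotate m) (fun w => ?_) fun w _ => by rw [periodicSeq_rotate]
  rw [mem_wordsWithOne, mem_wordsWithOne]
  constructor
  · rintro ⟨j, hj⟩
    exact ⟨j - 1, by rw [rotate_apply, sub_add_cancel, hj]⟩
  · rintro ⟨j, hj⟩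
    exact ⟨j + 1, hj⟩

theorem sum_wordsWithOne_iterate_shift (E : Seq3 → ℝ) (n : ℕ) :
    ∑ w ∈ SkewSystem.wordsWithOne m, E (shift^[n] (periodicSeq w)) =
      ∑ w ∈ SkewSystem.wordsWithOne m, E (periodicSeq w) := by
  induction n with
  | zero => rfl
  | succ n ih =>
    simp only [Function.iterate_succ_apply]
    rw [sum_wordsWithOne_shift fun ξ => E (shift^[n] ξ), ih]

theorem injOn_residue {s : Finset ℤ} (hs : ∀ i ∈ s, 2 * i.natAbs < m) :
    Set.InjOn (residue m) s := by
  intro i hi j hj hij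
  have h : i % m = j % m := by rw [← coe_residue, ← coe_residue, hij]
  have h1 : (m : ℤ) ∣ i - j := Int.dvd_of_emod_eq_zero (Int.emod_eq_emod_iff_emod_sub_eq_zero.1 h)
  have h2 := Int.eq_zero_of_abs_lt_dvd h1 (by
    have := hs i hi
    have := hs j hj
    rw [abs_lt]
    omega)
  omega

/-- For a period that is large compared to the coordinates in `s`, these coordinates are independent
and uniformly distributed with respect to the uniform distribution on all periodic sequences. -/
theorem sum_words_prod {s : Finset ℤ} (hs : ∀ i ∈ s, 2 * i.natAbs < m) (u : ℤ → Fin 3 → ℝ) :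
    ∑ w : Fin m → Fin 3, ∏ i ∈ s, u i (periodicSeq w i) = 3 ^ m * ∏ i ∈ s, (∑ a, u i a) / 3 := by
  classical
  have hinj := injOn_residue hs
  set v : Fin m → Fin 3 → ℝ := fun j a => ∏ i ∈ s with residue m i = j, u i a with hv
  have h1 : ∀ w : Fin m → Fin 3, ∏ i ∈ s, u i (periodicSeq w i) = ∏ j, v j (w j) := by
    intro w
    rw [← Finset.prod_fiberwise s (residue m)]
    refine Finset.prod_congr rfl fun j _ => Finset.prod_congr rfl fun i hi => ?_
    rw [periodicSeq_apply, (Finset.mem_filter.1 hi).2]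
  have h2 : ∏ j, (∑ a, v j a) / 3 = ∏ i ∈ s, (∑ a, u i a) / 3 := by
    have h3 : ∀ i ∈ s, v (residue m i) = u i := by
      intro i hi
      have h4 : (s.filter fun k => residue m k = residue m i) = {i} := by
        ext k
        simp only [Finset.mem_filter, Finset.mem_singleton]
        exact ⟨fun h => hinj h.1 hi h.2, fun h => by rw [h]; exact ⟨hi, rfl⟩⟩
      ext a
      simp only [hv, h4, Finset.prod_singleton]
    rw [← Finset.prod_subset (Finset.subset_univ (s.image (residue m))), Finset.prod_image hinj]
    · exact Finset.prod_congr rfl fun i hi => by rw [h3 i hi]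
    · intro j _ hj
      have h4 : (s.filter fun k => residue m k = j) = ∅ := by
        refine Finset.filter_eq_empty_iff.2 fun k hk hkj => hj ?_
        exact Finset.mem_image.2 ⟨k, hk, hkj⟩
      simp [hv, h4]
  simp only [h1]
  rw [← Fintype.prod_sum, ← h2, Finset.prod_div_distrib]
  simp
  field_simp

end Words

/-- The periodic sequences in which `1` occurs become equidistributed with respect to the Bernoulli
measure, because only `2 ^ m` of the `3 ^ m` words of length `m` do not contain `1`. -/
theorem tendsto_average_wordsWithOne (s : Finset ℤ) {u : ℤ → Fin 3 → ℝ}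
    (hu : ∀ i a, u i a ∈ Icc (0 : ℝ) 1) :
    Tendsto (fun k : ℕ => ((SkewSystem.wordsWithOne (k + 1)).card : ℝ)⁻¹ *
      ∑ w ∈ SkewSystem.wordsWithOne (k + 1), ∏ i ∈ s, u i (periodicSeq w i)) atTop
      (𝓝 (∏ i ∈ s, (∑ a, u i a) / 3)) := by
  set β := ∏ i ∈ s, (∑ a, u i a) / 3 with hβ
  set e : ℕ → ℝ := fun k =>
    ∑ w ∈ (SkewSystem.wordsWithOne (k + 1))ᶜ, ∏ i ∈ s, u i (periodicSeq w i) with he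
  have hprod : ∀ ξ : Seq3, ∏ i ∈ s, u i (ξ i) ∈ Icc (0 : ℝ) 1 := fun ξ =>
    ⟨Finset.prod_nonneg fun i _ => (hu i _).1,
      Finset.prod_le_one (fun i _ => (hu i _).1) fun i _ => (hu i _).2⟩
  have he0 : ∀ k, 0 ≤ e k / 3 ^ (k + 1) := fun k =>
    div_nonneg (Finset.sum_nonneg fun w _ => (hprod _).1) (by positivity)
  have he1 : ∀ k, e k / 3 ^ (k + 1) ≤ (2 / 3 : ℝ) ^ (k + 1) := fun k => by
    rw [div_pow]
    gcongr
    calc e k ≤ ∑ w ∈ (SkewSystem.wordsWithOne (k + 1))ᶜ, (1 : ℝ) :=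
          Finset.sum_le_sum fun w _ => (hprod _).2
      _ = 2 ^ (k + 1) := by
          rw [Finset.sum_const, card_words_without_one]
          simp
  have h23 : Tendsto (fun k : ℕ => (2 / 3 : ℝ) ^ (k + 1)) atTop (𝓝 0) :=
    (tendsto_pow_atTop_nhds_zero_of_lt_one (by norm_num) (by norm_num)).comp
      (tendsto_add_atTop_nat 1)
  have helim : Tendsto (fun k => e k / 3 ^ (k + 1)) atTop (𝓝 0) := squeeze_zero he0 he1 h23
  have hlim : Tendsto (fun k => (β - e k / 3 ^ (k + 1)) / (1 - (2 / 3 : ℝ) ^ (k + 1))) atTop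
      (𝓝 β) := by
    have := (tendsto_const_nhds (x := β)).sub helim |>.div
      ((tendsto_const_nhds (x := (1 : ℝ))).sub h23) (by norm_num)
    simp only [sub_zero, div_one] at this
    exact this
  refine hlim.congr' ?_
  filter_upwards [eventually_ge_atTop (∑ i ∈ s, 2 * i.natAbs)] with k hk
  have hs : ∀ i ∈ s, 2 * i.natAbs < k + 1 := fun i hi => by
    have := Finset.single_le_sum (f := fun i : ℤ => 2 * i.natAbs) (fun _ _ => Nat.zero_le _) hi
    omega
  have h1 := sum_words_prod hs u
  rw [← Finset.sum_add_sum_compl (SkewSystem.wordsWithOne (k + 1))] at h1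
  have h2 : ∑ w ∈ SkewSystem.wordsWithOne (k + 1), ∏ i ∈ s, u i (periodicSeq w i) =
      3 ^ (k + 1) * β - e k := by
    rw [← h1]
    simp only [he]
    ring
  rw [h2, card_wordsWithOne, div_pow]
  have h3 : (2 : ℝ) ^ (k + 1) < 3 ^ (k + 1) := by gcongr; norm_num
  have h4 : (3 : ℝ) ^ (k + 1) - 2 ^ (k + 1) ≠ 0 := by linarith [h3]
  field_simp

/-! ### The measures on periodic end points and their limits -/

namespace SkewSystem

variable {S : SkewSystem}

variable (S) in
/-- The measure `S.endpointMeasure m`, as a measure on `Λ`. -/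
noncomputable def endpointΛ (m : ℕ) [NeZero m] : Measure S.Λ :=
  ((wordsWithOne m).card : ENNReal)⁻¹ • ∑ w ∈ wordsWithOne m,
    (2 : ENNReal)⁻¹ • (Measure.dirac (S.left (periodicSeq w)) +
      Measure.dirac (S.right (periodicSeq w)))

theorem map_endpointΛ (m : ℕ) [NeZero m] :
    (S.endpointΛ m).map Subtype.val = S.endpointMeasure m := by
  have h : Measurable (Subtype.val : S.Λ → (ℝ × ℝ) × ℝ) := measurable_subtype_coe
  rw [endpointΛ, endpointMeasure, Measure.map_smul, Measure.map_finset_sum h.aemeasurable]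
  congr 1
  refine Finset.sum_congr rfl fun w _ => ?_
  rw [Measure.map_smul, Measure.map_add _ _ h, Measure.map_dirac' h, Measure.map_dirac' h]
  rfl

instance (m : ℕ) [NeZero m] : IsProbabilityMeasure (S.endpointΛ m) := by
  constructor
  have h : ((wordsWithOne m).card : ENNReal) ≠ 0 := by
    exact_mod_cast (card_wordsWithOne_pos (m := m)).ne'
  have h2 : (2 : ENNReal)⁻¹ * (1 + 1) = 1 := by
    rw [one_add_one_eq_two]
    exact ENNReal.inv_mul_cancel (by norm_num) (by norm_num)
  simp only [endpointΛ, Measure.smul_apply, Measure.finsetSum_apply, Measure.add_apply,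
    measure_univ, smul_eq_mul, h2, Finset.sum_const, nsmul_eq_mul, mul_one]
  exact ENNReal.inv_mul_cancel h (by simp)

theorem integral_endpointΛ (m : ℕ) [NeZero m] (g : S.Λ → ℝ) :
    ∫ X, g X ∂(S.endpointΛ m) = ((wordsWithOne m).card : ℝ)⁻¹ *
      ∑ w ∈ wordsWithOne m, 2⁻¹ * (g (S.left (periodicSeq w)) + g (S.right (periodicSeq w))) := by
  have hd : ∀ X : S.Λ, Integrable g (Measure.dirac X) := fun X => integrable_dirac (by simp)
  rw [endpointΛ, integral_smul_measure, integral_finsetSum_measure]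
  · simp only [integral_smul_measure, integral_add_measure (hd _) (hd _), integral_dirac]
    simp
  · exact fun w _ => ((hd _).add_measure (hd _)).smul_measure (by simp)

theorem integral_comp_iterate_endpointΛ (m : ℕ) [NeZero m] (g : S.Λ → ℝ) (n : ℕ) :
    ∫ X, g (S.FΛ^[n] X) ∂(S.endpointΛ m) = ∫ X, g X ∂(S.endpointΛ m) := by
  rw [integral_endpointΛ, integral_endpointΛ]
  simp only [add_iterate_FΛ_left_right]
  rw [sum_wordsWithOne_iterate_shift fun ξ => 2⁻¹ * (g (S.left ξ) + g (S.right ξ))]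

theorem integrable_logNorm (μ : Measure S.Λ) [IsFiniteMeasure μ] : Integrable S.logNorm μ :=
  continuous_logNorm.integrable_of_hasCompactSupport (HasCompactSupport.of_compactSpace _)

theorem integral_logNorm_endpointΛ_nonpos (m : ℕ) [NeZero m] :
    ∫ X, S.logNorm X ∂(S.endpointΛ m) ≤ 0 := by
  have hm := NeZero.pos m
  have h1 : ∫ X, ∑ j ∈ Finset.range (m + m), S.logNorm (S.FΛ^[j] X) ∂(S.endpointΛ m) ≤ 0 := by
    rw [integral_endpointΛ]
    refine mul_nonpos_of_nonneg_of_nonpos (by positivity) (Finset.sum_nonpos fun w hw => ?_)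
    obtain ⟨j, hj⟩ := exists_periodicSeq_eq_one hw
    have h2 := sum_logNorm_nonpos (S := S) hm (shiftBy_periodicSeq w) hj (Or.inl rfl)
    have h3 := sum_logNorm_nonpos (S := S) hm (shiftBy_periodicSeq w) hj (Or.inr rfl)
    linarith
  rw [integral_finsetSum] at h1
  · simp only [integral_comp_iterate_endpointΛ, Finset.sum_const, Finset.card_range,
      nsmul_eq_mul] at h1
    have hm' : (0 : ℝ) < (m + m : ℕ) := by exact_mod_cast (by omega : 0 < m + m)
    exact nonpos_of_mul_nonpos_right h1 hm'
  · intro j _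
    exact (continuous_logNorm.comp (continuous_FΛ.iterate j)).integrable_of_hasCompactSupport
      (HasCompactSupport.of_compactSpace _)

variable (S) in
/-- The measure `S.endpointΛ (k + 1)` as a point of the compact space of probability measures. -/
noncomputable def endpointProb (k : ℕ) : ProbabilityMeasure S.Λ :=
  ⟨S.endpointΛ (k + 1), inferInstance⟩

/-- Weak accumulation in the sense of test functions on `ℝ³` is weak accumulation in the space of
probability measures on the compact set `Λ`. -/
theorem isWeakAccumulation_iff (μ : ProbabilityMeasure S.Λ) : S.IsWeakAccumulation μ ↔
    ∃ φ : ℕ → ℕ, StrictMono φ ∧ Tendsto (S.endpointProb ∘ φ) atTop (𝓝 μ) := by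
  have hval : ∀ (k : ℕ) (g : BoundedContinuousFunction ((ℝ × ℝ) × ℝ) ℝ),
      ∫ X, g X ∂(S.endpointMeasure (k + 1)) = ∫ X : S.Λ, g X.1 ∂(S.endpointΛ (k + 1)) := by
    intro k g
    rw [← map_endpointΛ, integral_map measurable_subtype_coe.aemeasurable
      g.continuous.aestronglyMeasurable]
  refine exists_congr fun φ => and_congr_right fun _ => ?_
  rw [ProbabilityMeasure.tendsto_iff_forall_integral_tendsto]
  simp only [hval]
  constructor
  · intro h g
    obtain ⟨G, -, hG⟩ := BoundedContinuousFunction.exists_extension_norm_eq_of_isClosedEmbedding g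
      isCompact_Λ.isClosed.isClosedEmbedding_subtypeVal
    have hG' : ∀ X : S.Λ, G X.1 = g X := fun X => congrFun hG X
    have := h G
    simp only [hG'] at this
    exact this
  · intro h g
    exact h (g.compContinuous ⟨Subtype.val, continuous_subtype_val⟩)

theorem exists_isWeakAccumulation :
    ∃ μ : ProbabilityMeasure S.Λ, S.IsWeakAccumulation μ := by
  obtain ⟨μ, φ, hφ, h⟩ := CompactSpace.tendsto_subseq S.endpointProb
  exact ⟨μ, (isWeakAccumulation_iff μ).2 ⟨φ, hφ, h⟩⟩

section Limits

variable {μ : ProbabilityMeasure S.Λ}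

theorem IsWeakAccumulation.tendsto_integral (hμ : S.IsWeakAccumulation μ) :
    ∃ φ : ℕ → ℕ, StrictMono φ ∧ ∀ g : S.Λ → ℝ, Continuous g →
      Tendsto (fun k => ∫ X, g X ∂(S.endpointΛ (φ k + 1))) atTop (𝓝 (∫ X, g X ∂μ)) := by
  obtain ⟨φ, hφ, h⟩ := (isWeakAccumulation_iff μ).1 hμ
  refine ⟨φ, hφ, fun g hg => ?_⟩
  exact ProbabilityMeasure.tendsto_iff_forall_integral_tendsto.1 h
    (BoundedContinuousFunction.mkOfCompact ⟨g, hg⟩)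

theorem IsWeakAccumulation.measurePreserving (hμ : S.IsWeakAccumulation μ) :
    MeasurePreserving S.FΛ (μ : Measure S.Λ) μ := by
  obtain ⟨φ, -, h⟩ := hμ.tendsto_integral
  have hF := continuous_FΛ (S := S)
  refine ⟨hF.measurable, ?_⟩
  have : IsProbabilityMeasure ((μ : Measure S.Λ).map S.FΛ) :=
    Measure.isProbabilityMeasure_map hF.measurable.aemeasurable
  refine ext_of_forall_integral_eq_of_IsFiniteMeasure fun g => ?_
  rw [integral_map hF.measurable.aemeasurable g.continuous.aestronglyMeasurable]
  refine tendsto_nhds_unique (h _ (g.continuous.comp hF)) ((h _ g.continuous).congr fun k => ?_)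
  exact (integral_comp_iterate_endpointΛ (φ k + 1) g 1).symm

theorem IsWeakAccumulation.map_π (hμ : S.IsWeakAccumulation μ) :
    (μ : Measure S.Λ).map S.π = bernoulli3 := by
  classical
  obtain ⟨φ, hφ, h⟩ := hμ.tendsto_integral
  refine Measure.eq_infinitePi _ fun s t ht => ?_
  set u : ℤ → Fin 3 → ℝ := fun i => (t i).indicator 1 with hu
  have hu01 : ∀ i a, u i a ∈ Icc (0 : ℝ) 1 := fun i a => by
    by_cases ha : a ∈ t i <;> simp [hu, ha]
  set g : S.Λ → ℝ := fun X => ∏ i ∈ s, u i (S.π X i) with hg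
  have hgc : Continuous g := continuous_finsetProd _ fun i _ =>
    (continuous_of_discreteTopology (f := u i)).comp ((continuous_apply i).comp continuous_π)
  have hbox : MeasurableSet (Set.pi (s : Set ℤ) t) :=
    MeasurableSet.pi s.countable_toSet fun i _ => ht i
  have h1 : ∫ X, g X ∂μ = (μ : Measure S.Λ).real (S.π ⁻¹' Set.pi s t) := by
    rw [← integral_indicator_one (measurable_π hbox)]
    congr 1
    ext X
    by_cases hX : ∀ i ∈ s, S.π X i ∈ t i
    · rw [indicator_of_mem (show X ∈ S.π ⁻¹' Set.pi s t from hX)]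
      exact Finset.prod_eq_one fun i hi => by simp [hu, hX i hi]
    · rw [indicator_of_notMem (show X ∉ S.π ⁻¹' Set.pi s t from hX)]
      push Not at hX
      obtain ⟨i, hi, hit⟩ := hX
      exact Finset.prod_eq_zero hi (by simp [hu, hit])
  have h2 : Tendsto (fun k => ∫ X, g X ∂(S.endpointΛ (φ k + 1))) atTop
      (𝓝 (∏ i ∈ s, (∑ a, u i a) / 3)) := by
    refine ((tendsto_average_wordsWithOne s hu01).comp hφ.tendsto_atTop).congr fun k => ?_
    rw [integral_endpointΛ]
    simp only [Function.comp_apply, hg, left, right, π_point]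
    congr 1
    refine Finset.sum_congr rfl fun w _ => ?_
    ring
  have h3 := tendsto_nhds_unique (h g hgc) h2
  have h4 : ∀ i, (PMF.uniformOfFintype (Fin 3)).toMeasure.real (t i) = (∑ a, u i a) / 3 := by
    intro i
    have h5 : ∑ a, u i a = Fintype.card (t i) := by
      simp [hu, indicator_apply, Fintype.card_subtype]
    rw [Measure.real, PMF.toMeasure_uniformOfFintype_apply _ (ht i), h5]
    simp
  rw [Measure.map_apply measurable_π hbox, ← ENNReal.toReal_eq_toReal_iff' (measure_ne_top _ _)
    (ENNReal.prod_ne_top fun i _ => measure_ne_top _ _), ENNReal.toReal_prod]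
  simp only [← h4] at h3
  exact h1.symm.trans h3

theorem IsWeakAccumulation.integral_logNorm_nonpos (hμ : S.IsWeakAccumulation μ) :
    ∫ X, S.logNorm X ∂(μ : Measure S.Λ) ≤ 0 := by
  obtain ⟨φ, -, h⟩ := hμ.tendsto_integral
  exact le_of_tendsto' (h _ continuous_logNorm) fun k => integral_logNorm_endpointΛ_nonpos _

end Limits

end SkewSystem

/-! ### Ergodicity of the Bernoulli measure -/

theorem measurePreserving_shift_bernoulli3 : MeasurePreserving shift bernoulli3 bernoulli3 :=
  ⟨measurable_shift, Measure.map_infinitePi_infinitePi_of_inj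
    (P := fun _ : ℤ => (PMF.uniformOfFintype (Fin 3)).toMeasure) (add_left_injective 1)⟩

/-- A cylinder is independent of its preimages under high iterates of the shift. -/
theorem exists_measureReal_inter_preimage_shift {C : Set Seq3}
    (hC : C ∈ measurableCylinders fun _ : ℤ => Fin 3) :
    ∃ n : ℕ, bernoulli3.real (C ∩ shift^[n] ⁻¹' C) = bernoulli3.real C ^ 2 := by
  obtain ⟨s, A, hA, rfl⟩ := (mem_measurableCylinders C).1 hC
  set n : ℕ := ∑ i ∈ s, 2 * i.natAbs + 1 with hn
  have hs : ∀ i ∈ s, 2 * i.natAbs < n := fun i hi => by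
    have := Finset.single_le_sum (f := fun i : ℤ => 2 * i.natAbs) (fun _ _ => Nat.zero_le _) hi
    omega
  set t : Finset ℤ := s.image (· + (n : ℤ)) with ht
  have hst : Disjoint s t := by
    rw [Finset.disjoint_left]
    intro i hi hit
    obtain ⟨j, hj, hji⟩ := Finset.mem_image.1 hit
    have := hs i hi
    have := hs j hj
    omega
  have hmem : ∀ i : s, (i : ℤ) + n ∈ t := fun i => Finset.mem_image_of_mem _ i.2
  have hind := (ProbabilityTheory.iIndepFun_infinitePi
    (P := fun _ : ℤ => (PMF.uniformOfFintype (Fin 3)).toMeasure)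
    (X := fun _ a => a) fun _ => measurable_id).indepFun_finset s t hst
    fun i => measurable_pi_apply i
  set A' : Set (t → Fin 3) := (fun η (i : s) => η ⟨i + n, hmem i⟩) ⁻¹' A with hA'
  have hA'm : MeasurableSet A' := hA.preimage (by fun_prop)
  have h1 : shift^[n] ⁻¹' cylinder s A = (fun (ξ : Seq3) (i : t) => ξ i) ⁻¹' A' := by
    ext ξ
    simp only [mem_preimage, iterate_shift, mem_cylinder, hA']
    rfl
  have h2 := hind.measure_inter_preimage_eq_mul A A' hA hA'm
  refine ⟨n, ?_⟩
  have h3 : bernoulli3 (shift^[n] ⁻¹' cylinder s A) = bernoulli3 (cylinder s A) :=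
    (measurePreserving_shift_bernoulli3.iterate n).measure_preimage
      (MeasurableSet.cylinder s hA).nullMeasurableSet
  have h4 : bernoulli3 (cylinder s A ∩ shift^[n] ⁻¹' cylinder s A) =
      bernoulli3 (cylinder s A) * bernoulli3 (cylinder s A) := by
    conv_rhs => arg 2; rw [← h3]
    rw [h1]
    exact h2
  rw [Measure.real, h4, ENNReal.toReal_mul, sq]
  rfl

theorem ergodic_shift_bernoulli3 : Ergodic shift bernoulli3 := by
  refine ⟨measurePreserving_shift_bernoulli3, ⟨fun A hA hinv => ?_⟩⟩
  have hinvn : ∀ n : ℕ, shift^[n] ⁻¹' A = A := fun n => by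
    induction n with
    | zero => rfl
    | succ n ih => rw [Function.iterate_succ, preimage_comp, ih, hinv]
  have hdense : bernoulli3.MeasureDense (measurableCylinders fun _ : ℤ => Fin 3) :=
    Measure.MeasureDense.of_generateFrom_isSetAlgebra_finite _ isSetAlgebra_measurableCylinders
      generateFrom_measurableCylinders.symm
  set r := bernoulli3.real A with hr
  have hr0 : 0 ≤ r := measureReal_nonneg
  have hr1 : r ≤ 1 := measureReal_le_one
  -- `A` is close to a cylinder `C` that is independent of some `σ⁻ⁿ C`, while `A = σ⁻ⁿ A`
  have key : ∀ ε : ℝ, 0 < ε → |r - r ^ 2| ≤ 4 * ε := by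
    intro ε hε
    obtain ⟨C, hC, hCε⟩ := hdense.approx A hA (measure_ne_top _ _) ε hε
    have hCm := MeasurableSet.of_mem_measurableCylinders hC
    have hAC : bernoulli3.real (symmDiff A C) ≤ ε :=
      ENNReal.toReal_le_of_le_ofReal hε.le hCε.le
    obtain ⟨n, hn⟩ := exists_measureReal_inter_preimage_shift hC
    have hpre : bernoulli3.real (shift^[n] ⁻¹' symmDiff A C) ≤ ε := by
      rwa [Measure.real, (measurePreserving_shift_bernoulli3.iterate n).measure_preimage
        (hA.symmDiff hCm).nullMeasurableSet]
    have h1 := abs_measureReal_sub_le_measureReal_symmDiff (μ := bernoulli3) hA.nullMeasurableSet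
      hCm.nullMeasurableSet
    have hsub : symmDiff A (C ∩ shift^[n] ⁻¹' C) ⊆
        symmDiff A C ∪ shift^[n] ⁻¹' symmDiff A C := by
      intro ξ hξ
      have h5 : shift^[n] ξ ∈ A ↔ ξ ∈ A := by
        rw [← mem_preimage, hinvn]
      simp only [mem_union, mem_symmDiff, mem_preimage, mem_inter_iff, h5] at hξ ⊢
      tauto
    have h2 : |r - bernoulli3.real C ^ 2| ≤ 2 * ε := by
      rw [← hn]
      refine (abs_measureReal_sub_le_measureReal_symmDiff hA.nullMeasurableSet
        (hCm.inter ((measurable_shift.iterate n) hCm)).nullMeasurableSet).trans ?_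
      refine (measureReal_mono hsub).trans ((measureReal_union_le _ _).trans ?_)
      linarith
    have h3 : |bernoulli3.real C ^ 2 - r ^ 2| ≤ 2 * ε := by
      have hc0 : 0 ≤ bernoulli3.real C := measureReal_nonneg
      have hc1 : bernoulli3.real C ≤ 1 := measureReal_le_one
      rw [sq_sub_sq, abs_mul, abs_of_nonneg (by positivity), abs_sub_comm]
      nlinarith [abs_nonneg (r - bernoulli3.real C)]
    calc |r - r ^ 2| ≤ |r - bernoulli3.real C ^ 2| + |bernoulli3.real C ^ 2 - r ^ 2| :=
          abs_sub_le _ _ _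
      _ ≤ 4 * ε := by linarith
  have h0 : r - r ^ 2 = 0 := by
    rw [← abs_nonpos_iff]
    refine le_of_forall_pos_le_add fun ε hε => ?_
    have := key (ε / 4) (by positivity)
    linarith
  have h01 : r = 0 ∨ r = 1 := by
    rcases mul_eq_zero.1 (show r * (1 - r) = 0 by linarith) with h | h
    exacts [Or.inl h, Or.inr (by linarith)]
  rw [eventuallyConst_set]
  rcases h01 with h | h
  · right
    have : bernoulli3 A = 0 := (measureReal_eq_zero_iff).1 h
    exact measure_eq_zero_iff_ae_notMem.1 this
  · left
    refine (mem_ae_iff_prob_eq_one hA).2 ?_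
    rwa [hr, Measure.real, ENNReal.toReal_eq_one_iff] at h

/-! ### Ergodic measures in faces of the simplex of invariant measures -/

section Face

variable {X : Type*} [TopologicalSpace X] [CompactSpace X] [MeasurableSpace X] [BorelSpace X]

theorem continuous_integral_probabilityMeasure {g : X → ℝ} (hg : Continuous g) :
    Continuous fun μ : ProbabilityMeasure X => ∫ x, g x ∂(μ : Measure X) :=
  continuous_iff_continuousAt.2 fun _ =>
    ProbabilityMeasure.tendsto_iff_forall_integral_tendsto.1 tendsto_id
      (BoundedContinuousFunction.mkOfCompact ⟨g, hg⟩)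

variable [TopologicalSpace.MetrizableSpace X]

theorem integrable_of_continuous (μ : Measure X) [IsFiniteMeasure μ] {g : X → ℝ}
    (hg : Continuous g) : Integrable g μ :=
  hg.integrable_of_hasCompactSupport (HasCompactSupport.of_compactSpace _)

theorem measure_eq_of_forall_integral_denseSeq {ν₁ ν₂ : Measure X} [IsProbabilityMeasure ν₁]
    [IsProbabilityMeasure ν₂] (h : ∀ i, ∫ x, TopologicalSpace.denseSeq C(X, ℝ) i x ∂ν₁ =
      ∫ x, TopologicalSpace.denseSeq C(X, ℝ) i x ∂ν₂) : ν₁ = ν₂ := by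
  have hcont : ∀ ν : Measure X, IsProbabilityMeasure ν →
      Continuous fun g : C(X, ℝ) => ∫ x, g x ∂ν := by
    intro ν _
    refine (LipschitzWith.of_dist_le_mul (K := 1) fun f g => ?_).continuous
    rw [dist_eq_norm, ← integral_sub (integrable_of_continuous ν f.continuous)
      (integrable_of_continuous ν g.continuous)]
    refine (norm_integral_le_of_norm_le_const (C := dist f g) (ae_of_all _ fun x => ?_)).trans ?_
    · rw [← dist_eq_norm]
      exact ContinuousMap.dist_apply_le_dist x
    · simp
  have heq := Continuous.ext_on (TopologicalSpace.denseRange_denseSeq C(X, ℝ))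
    (hcont ν₁ inferInstance) (hcont ν₂ inferInstance) (by rintro _ ⟨i, rfl⟩; exact h i)
  exact ext_of_forall_integral_eq_of_IsFiniteMeasure fun g => congrFun heq g.toContinuousMap

theorem integral_convexCombination {ν₁ ν₂ : Measure X} [IsProbabilityMeasure ν₁]
    [IsProbabilityMeasure ν₂] {a b : ENNReal} (ha : a ≠ ⊤) (hb : b ≠ ⊤) {g : X → ℝ}
    (hg : Continuous g) :
    ∫ x, g x ∂(a • ν₁ + b • ν₂) = a.toReal * ∫ x, g x ∂ν₁ + b.toReal * ∫ x, g x ∂ν₂ := by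
  rw [integral_add_measure ((integrable_of_continuous ν₁ hg).smul_measure ha)
    ((integrable_of_continuous ν₂ hg).smul_measure hb), integral_smul_measure,
    integral_smul_measure]
  rfl

/-- A nonempty compact face of the simplex of invariant probability measures contains an ergodic
measure: a point of the face where a strictly convex continuous function is maximal is extreme. The
function is a weighted sum of the squares of the integrals of a dense sequence of functions. -/
theorem exists_ergodic_of_face {T : X → X} {K : Set (ProbabilityMeasure X)} (hK : IsCompact K)
    (hne : K.Nonempty) (hinv : ∀ μ ∈ K, MeasurePreserving T (μ : Measure X) μ)
    (hface : ∀ μ ∈ K, ∀ ν₁ ν₂ : ProbabilityMeasure X, MeasurePreserving T (ν₁ : Measure X) ν₁ →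
      MeasurePreserving T (ν₂ : Measure X) ν₂ → ∀ a b : ENNReal, 0 < a → 0 < b → a + b = 1 →
      a • (ν₁ : Measure X) + b • (ν₂ : Measure X) = μ → ν₁ ∈ K ∧ ν₂ ∈ K) :
    ∃ μ ∈ K, Ergodic T (μ : Measure X) := by
  set g := TopologicalSpace.denseSeq C(X, ℝ) with hg
  set c : ℕ → ℝ := fun i => (1 / 2) ^ i / (1 + ‖g i‖) ^ 2 with hc
  have hc0 : ∀ i, 0 < c i := fun i => by positivity
  set I : ProbabilityMeasure X → ℕ → ℝ := fun μ i => ∫ x, g i x ∂(μ : Measure X) with hI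
  have hbound : ∀ (μ : ProbabilityMeasure X) i, c i * I μ i ^ 2 ≤ (1 / 2 : ℝ) ^ i := by
    intro μ i
    have h1 : |I μ i| ≤ 1 + ‖g i‖ := by
      have := norm_integral_le_of_norm_le_const (μ := (μ : Measure X)) (f := g i) (C := ‖g i‖)
        (ae_of_all _ fun x => (g i).norm_coe_le_norm x)
      simp only [probReal_univ, mul_one, Real.norm_eq_abs] at this
      simp only [hI]
      linarith
    have h2 : I μ i ^ 2 ≤ (1 + ‖g i‖) ^ 2 := sq_le_sq' (by linarith [abs_le.1 h1]) (abs_le.1 h1).2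
    calc c i * I μ i ^ 2 ≤ c i * (1 + ‖g i‖) ^ 2 := by gcongr
      _ = (1 / 2) ^ i := by simp only [hc]; field_simp
  have hgeom : Summable fun i : ℕ => (1 / 2 : ℝ) ^ i := summable_geometric_two
  have hsum : ∀ μ, Summable fun i => c i * I μ i ^ 2 := fun μ =>
    hgeom.of_nonneg_of_le (fun i => mul_nonneg (hc0 i).le (sq_nonneg _)) (hbound μ)
  set ψ : ProbabilityMeasure X → ℝ := fun μ => ∑' i, c i * I μ i ^ 2 with hψ
  have hψc : Continuous ψ := by
    refine continuous_tsum (fun i => ?_) hgeom fun i μ => ?_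
    · exact ((continuous_integral_probabilityMeasure (g i).continuous).pow 2).const_mul _
    · rw [Real.norm_eq_abs, abs_of_nonneg (mul_nonneg (hc0 i).le (sq_nonneg _))]
      exact hbound μ i
  obtain ⟨μ, hμK, hμ⟩ := hK.exists_isMaxOn hne hψc.continuousOn
  refine ⟨μ, hμK, Ergodic.of_mem_extremePoints (mem_extremePoints_iff_left.2
    ⟨⟨hinv μ hμK, inferInstance⟩, ?_⟩)⟩
  rintro ν₁ ⟨hν₁, _⟩ ν₂ ⟨hν₂, _⟩ ⟨a, b, ha, hb, hab, h⟩
  obtain ⟨h1, h2⟩ := hface μ hμK ⟨ν₁, ‹_›⟩ ⟨ν₂, ‹_›⟩ hν₁ hν₂ a b ha hb hab h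
  have hatop : a ≠ ⊤ := ne_top_of_le_ne_top ENNReal.one_ne_top (hab ▸ le_self_add)
  have hbtop : b ≠ ⊤ := ne_top_of_le_ne_top ENNReal.one_ne_top (hab ▸ le_add_self)
  have ha' : 0 < a.toReal := ENNReal.toReal_pos ha.ne' hatop
  have hb' : 0 < b.toReal := ENNReal.toReal_pos hb.ne' hbtop
  have hab' : a.toReal + b.toReal = 1 := by
    rw [← ENNReal.toReal_add hatop hbtop, hab, ENNReal.toReal_one]
  have hIμ : ∀ i, I μ i = a.toReal * I ⟨ν₁, ‹_›⟩ i + b.toReal * I ⟨ν₂, ‹_›⟩ i := fun i => by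
    simp only [hI, ← h]
    exact integral_convexCombination hatop hbtop (g i).continuous
  generalize hN₁ : (⟨ν₁, ‹_›⟩ : ProbabilityMeasure X) = N₁ at *
  generalize hN₂ : (⟨ν₂, ‹_›⟩ : ProbabilityMeasure X) = N₂ at *
  have hdefect : HasSum (fun i => c i * (a.toReal * b.toReal * (I N₁ i - I N₂ i) ^ 2))
      (a.toReal * ψ N₁ + b.toReal * ψ N₂ - ψ μ) := by
    have h3 := (((hsum N₁).hasSum.mul_left a.toReal).add
      ((hsum N₂).hasSum.mul_left b.toReal)).sub (hsum μ).hasSum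
    convert! h3 using 2 with i
    rw [hIμ i, eq_sub_of_add_eq' hab']
    ring
  have hle : a.toReal * ψ N₁ + b.toReal * ψ N₂ - ψ μ ≤ 0 := by
    have h3 : ψ N₁ ≤ ψ μ := hμ h1
    have h4 : ψ N₂ ≤ ψ μ := hμ h2
    have h5 : ψ μ = a.toReal * ψ μ + b.toReal * ψ μ := by rw [← add_mul, hab', one_mul]
    nlinarith
  have hEq : ∀ i, I N₁ i = I N₂ i := by
    intro i
    have h3 := le_hasSum hdefect i fun j _ => by have := hc0 j; positivity
    have h4 : c i * (a.toReal * b.toReal * (I N₁ i - I N₂ i) ^ 2) = 0 :=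
      le_antisymm (h3.trans hle) (by have := hc0 i; positivity)
    have h5 : (I N₁ i - I N₂ i) ^ 2 = 0 := by
      simpa [(hc0 i).ne', ha'.ne', hb'.ne'] using h4
    linarith [pow_eq_zero_iff (two_ne_zero) |>.1 h5]
  subst hN₁ hN₂
  have hν : ν₁ = ν₂ := measure_eq_of_forall_integral_denseSeq hEq
  rw [← h, ← hν, ← add_smul, hab, one_smul]

end Face

namespace SkewSystem

variable {S : SkewSystem}

/-- Among the invariant measures over the Bernoulli measure, those with the least central exponent
form a face of the simplex of invariant measures. -/
theorem exists_ergodic_logNorm_nonpos : ∃ μ : ProbabilityMeasure S.Λ,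
    Ergodic S.FΛ (μ : Measure S.Λ) ∧ (μ : Measure S.Λ).map S.π = bernoulli3 ∧
      ∫ X, S.logNorm X ∂(μ : Measure S.Λ) ≤ 0 := by
  obtain ⟨μ₀, hμ₀⟩ := exists_isWeakAccumulation (S := S)
  set K : Set (ProbabilityMeasure S.Λ) := {μ | MeasurePreserving S.FΛ (μ : Measure S.Λ) μ ∧
    (μ : Measure S.Λ).map S.π = bernoulli3} with hK
  have hKclosed : IsClosed K := by
    have hF := continuous_FΛ (S := S)
    have hπ := continuous_π (S := S)
    have h1 : K = {μ | μ.map hF.measurable.aemeasurable = μ} ∩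
        {μ | μ.map hπ.measurable.aemeasurable = ⟨bernoulli3, inferInstance⟩} := by
      ext μ
      simp only [hK, mem_ofPred_eq, mem_inter_iff]
      refine and_congr ⟨fun h => Subtype.ext h.map_eq, fun h => ⟨hF.measurable, ?_⟩⟩
        ⟨fun h => Subtype.ext h, fun h => congrArg Subtype.val h⟩
      exact congrArg Subtype.val h
    rw [h1]
    exact (isClosed_eq (ProbabilityMeasure.continuous_map hF) continuous_id).inter
      (isClosed_eq (ProbabilityMeasure.continuous_map hπ) continuous_const)
  have hχ := continuous_integral_probabilityMeasure (continuous_logNorm (S := S))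
  have hμ₀K : μ₀ ∈ K := ⟨hμ₀.measurePreserving, hμ₀.map_π⟩
  obtain ⟨μ₁, hμ₁K, hμ₁⟩ := hKclosed.isCompact.exists_isMinOn ⟨μ₀, hμ₀K⟩ hχ.continuousOn
  set c := ∫ X, S.logNorm X ∂(μ₁ : Measure S.Λ) with hc
  have hmin : ∀ μ ∈ K, c ≤ ∫ X, S.logNorm X ∂(μ : Measure S.Λ) := fun μ hμ => hμ₁ hμ
  have hc0 : c ≤ 0 := (hmin μ₀ hμ₀K).trans hμ₀.integral_logNorm_nonpos
  set K' := K ∩ {μ | ∫ X, S.logNorm X ∂(μ : Measure S.Λ) = c} with hK'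
  have hK'c : IsCompact K' := (hKclosed.inter (isClosed_eq hχ continuous_const)).isCompact
  refine Exists.elim (exists_ergodic_of_face (T := S.FΛ) hK'c ⟨μ₁, hμ₁K, rfl⟩
    (fun μ hμ => hμ.1.1) ?_) fun μ ⟨hμ, hE⟩ => ⟨μ, hE, hμ.1.2, hμ.2.le.trans hc0⟩
  · intro μ hμ ν₁ ν₂ hν₁ hν₂ a b ha hb hab h
    have hatop : a ≠ ⊤ := ne_top_of_le_ne_top ENNReal.one_ne_top (hab ▸ le_self_add)
    have hbtop : b ≠ ⊤ := ne_top_of_le_ne_top ENNReal.one_ne_top (hab ▸ le_add_self)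
    have hπm := measurable_π (S := S)
    -- an invariant measure over a part of the ergodic Bernoulli measure lies over all of it
    have hproj : ∀ ν : ProbabilityMeasure S.Λ, MeasurePreserving S.FΛ (ν : Measure S.Λ) ν →
        (ν : Measure S.Λ) ≪ μ → ν ∈ K := by
      intro ν hν hac
      have : IsProbabilityMeasure ((ν : Measure S.Λ).map S.π) :=
        Measure.isProbabilityMeasure_map hπm.aemeasurable
      refine ⟨hν, ergodic_shift_bernoulli3.eq_of_absolutelyContinuous ⟨measurable_shift, ?_⟩ ?_⟩
      · have h1 : shift ∘ S.π = S.π ∘ S.FΛ := funext fun X => (π_FΛ X).symm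
        rw [Measure.map_map measurable_shift hπm, h1, ← Measure.map_map hπm hν.measurable,
          hν.map_eq]
      · rw [← hμ.1.2]
        exact hac.map hπm
    have h1 : ν₁ ∈ K := hproj ν₁ hν₁ (by
      rw [← h]
      exact (Measure.absolutelyContinuous_smul ha.ne').trans
        (Measure.AbsolutelyContinuous.rfl.add_right _))
    have h2 : ν₂ ∈ K := hproj ν₂ hν₂ (by
      rw [← h, add_comm]
      exact (Measure.absolutelyContinuous_smul hb.ne').trans
        (Measure.AbsolutelyContinuous.rfl.add_right _))
    have ha' : 0 < a.toReal := ENNReal.toReal_pos ha.ne' hatop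
    have hb' : 0 < b.toReal := ENNReal.toReal_pos hb.ne' hbtop
    have hab' : a.toReal + b.toReal = 1 := by
      rw [← ENNReal.toReal_add hatop hbtop, hab, ENNReal.toReal_one]
    have h3 : ∫ X, S.logNorm X ∂(μ : Measure S.Λ) = c := hμ.2
    rw [← h, integral_convexCombination hatop hbtop continuous_logNorm] at h3
    have h4 := hmin ν₁ h1
    have h5 := hmin ν₂ h2
    have h6 : c = a.toReal * c + b.toReal * c := by rw [← add_mul, hab', one_mul]
    refine ⟨⟨h1, le_antisymm ?_ h4⟩, ⟨h2, le_antisymm ?_ h5⟩⟩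
    · by_contra! hlt
      nlinarith [mul_lt_mul_of_pos_left hlt ha', mul_le_mul_of_nonneg_left h5 hb'.le]
    · by_contra! hlt
      nlinarith [mul_lt_mul_of_pos_left hlt hb', mul_le_mul_of_nonneg_left h4 ha'.le]

end SkewSystem

end SkewHorseshoe

open SkewHorseshoe in
theorem mainTheorem5 (S : SkewSystem) :
    (∃ μ : Measure S.Λ, IsProbabilityMeasure μ ∧ Ergodic S.FΛ μ ∧
      entropy S.FΛ μ = (Real.log 3 : ℝ) ∧
      (∀ ν : Measure S.Λ, IsProbabilityMeasure ν → MeasurePreserving S.FΛ ν ν →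
        entropy S.FΛ ν ≤ entropy S.FΛ μ) ∧
      μ.map S.π = bernoulli3 ∧
      Integrable (fun X : S.Λ => Real.log (S.centralNorm X.1)) μ ∧ S.χ μ ≤ 0) ∧
    (∃ μ : Measure S.Λ, IsProbabilityMeasure μ ∧ S.IsWeakAccumulation μ) ∧
    (∀ μ : Measure S.Λ, IsProbabilityMeasure μ → S.IsWeakAccumulation μ →
      MeasurePreserving S.FΛ μ μ ∧ μ.map S.π = bernoulli3 ∧
      entropy S.FΛ μ = (Real.log 3 : ℝ) ∧
      Integrable (fun X : S.Λ => Real.log (S.centralNorm X.1)) μ ∧ S.χ μ ≤ 0) := by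
  refine ⟨?_, ?_, fun μ _ hμ => ?_⟩
  · obtain ⟨μ, hE, hπ, hχ⟩ := SkewSystem.exists_ergodic_logNorm_nonpos (S := S)
    have hent := SkewSystem.entropy_eq_log_three hE.toMeasurePreserving hπ
    refine ⟨μ, inferInstance, hE, hent, fun ν _ hν => ?_, hπ, SkewSystem.integrable_logNorm _, hχ⟩
    rw [hent]
    exact SkewSystem.entropy_le_log_three hν
  · obtain ⟨μ, hμ⟩ := SkewSystem.exists_isWeakAccumulation (S := S)
    exact ⟨μ, inferInstance, hμ⟩
  · have hμ' : S.IsWeakAccumulation ((⟨μ, ‹_›⟩ : ProbabilityMeasure S.Λ) : Measure S.Λ) := hμ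
    have hF : MeasurePreserving S.FΛ μ μ := hμ'.measurePreserving
    have hπ : μ.map S.π = bernoulli3 := hμ'.map_π
    exact ⟨hF, hπ, SkewSystem.entropy_eq_log_three hF hπ, SkewSystem.integrable_logNorm _,
      hμ'.integral_logNorm_nonpos⟩
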